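/- Let $\mathbb R^n$ carry a scalar product, let $A\in\mathrm{Hom}(\mathbb R^n)$, and let $B:[0,\infty)\to\mathrm{Hom}(\mathbb R^n)$ be continuous and bounded. Assume that the characteristic polynomial of $A$ has no (complex) root with real part $1$, and that the system $$y'=\Big(\frac Ax+B(x)\Big)y,\qquad x>0, \tag{1}$$ is exponentially dichotomic on $[a,\infty)$ for some $a>0$. Fix $x_0>0$ and let $Y(x;x_0)$, $x>0$, be the evolution operator of (1) with $Y(x_0;x_0)=E$ (the identity); write $Y^{-1}(s;x_0)=(Y(s;x_0))^{-1}$. Define subspaces of initial values at $x_0$ as follows. $\mathbb V_+$ is the set of $y_0$ with $Y(x;x_0)y_0=O(x^{1+\alpha})$ as $x\to+0$ for some $\alpha>0$; $\mathbb U_-$ is the set of $y_0$ with $Y(x;x_0)y_0=O(e^{-\gamma x})$ as $x\to+\infty$ for some $\gamma>0$; $\mathbb V_-^0$ is a subspace with $\mathbb V_+\cap\mathbb V_-^0=\{0\}$ such that $\mathbb V_+\oplus\mathbb V_-^0$ is the space of those $y_0$ for which $Y(x;x_0)y_0$ extends to a $C^1$ function on $[0,\infty)$. Let $\mathbb L_1=\mathbb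 U_-\cap\mathbb V_+$ and let $\mathbb L_2,\dots,\mathbb L_6$ be any subspaces with $$\mathbb L_1\oplus\mathbb L_2=\mathbb U_-\cap(\mathbb V_+\oplus\mathbb V_-^0),\quad \big(\mathbb U_-\cap(\mathbb V_+\oplus\mathbb V_-^0)\big)\oplus\mathbb L_3=\mathbb U_-,\quad \mathbb L_1\oplus\mathbb L_4=\mathbb V_+,$$ $$\Big(\big(\mathbb U_-\cap(\mathbb V_+\oplus\mathbb V_-^0)\big)\oplus\mathbb L_4\Big)\oplus\mathbb L_5=\mathbb V_+\oplus\mathbb V_-^0,\quad \mathbb L_5\subset\mathbb V_-^0,\qquad (\mathbb U_-\oplus\mathbb L_4\oplus\mathbb L_5)\oplus\mathbb L_6=\mathbb R^n .$$ Then $\mathbb R^n=\mathbb L_1\oplus\dots\oplus\mathbb L_6$; let $P_1,\dots,P_6$ be the corresponding projectors. Put $$D=\{(x,s):0<x<s<x_0\}\cup\{(x,s):x_0\le s\le x\},\quad D_+=\{(x,s):0<s\le x\},\quad D_-=\{(x,s):0<x<s\},$$ $$G_1(x,s)=\begin{cases}Y(x;x_0)P_1Y^{-1}(s;x_0),&(x,s)\in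 D\cap D_+,\\-Y(x;x_0)P_1Y^{-1}(s;x_0),&(x,s)\in D\cap D_-,\\0,&(x,s)\in(D_+\cup D_-)\setminus D,\end{cases}$$ $$G_2(x,s)=\begin{cases}Y(x;x_0)(P_2+P_3)Y^{-1}(s;x_0),&(x,s)\in D_+,\\-Y(x;x_0)(P_4+P_5+P_6)Y^{-1}(s;x_0),&(x,s)\in D_-,\end{cases}$$ and $G=G_1+G_2$. Let $g:[0,\infty)\to\mathbb R^n$ be continuous with $g(x)\to0$ as $x\to+\infty$, and consider the boundary value problem $$y'=\Big(\frac Ax+B(x)\Big)y+g(x)\ \ (x>0),\qquad y\in C^1([0,\infty)\to\mathbb R^n),\quad y(+0)=0,\quad y(+\infty)=0. \tag{2}$$ Then the integrals below converge absolutely (the second one for every $x>0$), and problem (2) has a solution if and only if $$\int_0^\infty (P_5+P_6)Y^{-1}(s;x_0)g(s)\,ds=0. \tag{3}$$ If (3) holds, then the solutions of (2) are exactly the functions $y$ with $y(0)=0$ and $$y(x)=Y(x;x_0)v+\int_0^\infty G(x,s)g(s)\,ds,\qquad x>0,$$ where $v$ ranges over $\mathbb L_1$. -/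

import Mathlib

open Set Filter Topology MeasureTheory Asymptotics

namespace SingularODE

section Evolution

variable {E : Type*} [NormedAddCommGroup E] [NormedSpace ℝ E]

/-- The coefficient `A / x + B(x)` of the linear system. -/
noncomputable def coeff (A : E →L[ℝ] E) (B : ℝ → E →L[ℝ] E) (x : ℝ) : E →L[ℝ] E :=
  x⁻¹ • A + B x

/-- `Y` is the evolution operator on `(0, ∞)` of `y' = (A / x + B(x)) y`, normalized at `x₀`:
`Y' = (A / x + B(x)) Y` for `x > 0`, and `Y(x₀)` is the identity. -/
structure IsEvolutionOperator (A : E →L[ℝ] E) (B : ℝ → E →L[ℝ] E) (x₀ : ℝ)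
    (Y : ℝ → E →L[ℝ] E) : Prop where
  apply_base : Y x₀ = 1
  hasDerivAt : ∀ x, 0 < x → HasDerivAt Y (coeff A B x * Y x) x

/-- The evolution operator `Y(x; x₀)`, i.e. the solution of `Y' = (A / x + B(x)) Y` on `(0, ∞)`
with `Y(x₀; x₀)` the identity. It exists by `evolution_spec` below (its values on `(0, ∞)` are
determined by linearity of the equation, those at `x ≤ 0` carry no meaning and are never used). -/
noncomputable def evolution (A : E →L[ℝ] E) (B : ℝ → E →L[ℝ] E) (x₀ : ℝ) : ℝ → E →L[ℝ] E :=
  Classical.epsilon (IsEvolutionOperator A B x₀)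

/-- The inverse `Y⁻¹(s; x₀)` of the evolution operator. -/
noncomputable def evolutionInv (A : E →L[ℝ] E) (B : ℝ → E →L[ℝ] E) (x₀ s : ℝ) : E →L[ℝ] E :=
  Ring.inverse (evolution A B x₀ s)

/-- The iterated integrals of the Peano-Baker series; only used to construct a solution. -/
noncomputable def peanoBaker (M : ℝ → E →L[ℝ] E) (x₀ : ℝ) : ℕ → ℝ → E →L[ℝ] E
  | 0 => fun _ => 1
  | k + 1 => fun x => ∫ s in x₀..x, M s * peanoBaker M x₀ k s

variable [CompleteSpace E]

theorem peanoBaker_continuousOn (M : ℝ → E →L[ℝ] E) {x₀ : ℝ} (hx₀ : 0 < x₀)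
    (hM : ContinuousOn M (Ioi 0)) (k : ℕ) :
    ContinuousOn (peanoBaker M x₀ k) (Ioi 0) ∧
    ∀ x, 0 < x → HasDerivAt (peanoBaker M x₀ (k + 1)) (M x * peanoBaker M x₀ k x) x := by
  have key : ∀ F : ℝ → E →L[ℝ] E, ContinuousOn F (Ioi 0) →
      ∀ x, 0 < x → HasDerivAt (fun x => ∫ s in x₀..x, F s) (F x) x := by
    intro F hF x hx
    refine intervalIntegral.integral_hasDerivAt_right ?_ ?_ (hF.continuousAt (Ioi_mem_nhds hx))
    · refine (hF.mono ?_).intervalIntegrable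
      intro t ht
      exact lt_of_lt_of_le (lt_min hx₀ hx) ht.1
    · exact hF.stronglyMeasurableAtFilter isOpen_Ioi x hx
  induction k with
  | zero => exact ⟨continuousOn_const, key _ (hM.mul continuousOn_const)⟩
  | succ k ih =>
    have hc : ContinuousOn (peanoBaker M x₀ (k + 1)) (Ioi 0) :=
      fun x hx => (ih.2 x hx).continuousAt.continuousWithinAt
    exact ⟨hc, key _ (hM.mul hc)⟩

theorem peanoBaker_norm_le (M : ℝ → E →L[ℝ] E) {x₀ a b C : ℝ} (hx₀ : 0 < x₀) (ha : 0 < a)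
    (hax : a ≤ x₀) (hxb : x₀ ≤ b) (hM : ContinuousOn M (Ioi 0))
    (hC : ∀ x ∈ Icc a b, ‖M x‖ ≤ C) (k : ℕ) :
    ∀ x ∈ Icc a b, ‖peanoBaker M x₀ k x‖ ≤ C ^ k * |x - x₀| ^ k / k.factorial := by
  have hC0 : 0 ≤ C := (norm_nonneg _).trans (hC x₀ ⟨hax, hxb⟩)
  induction k with
  | zero =>
    intro x _
    simpa [peanoBaker, ContinuousLinearMap.one_def] using
      ContinuousLinearMap.norm_id_le (𝕜 := ℝ) (E := E)
  | succ k ih =>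
    intro x hx
    have hsub : uIoc x₀ x ⊆ Icc a b := by
      intro t ht
      rcases mem_uIoc.1 ht with h | h
      · exact ⟨hax.trans h.1.le, h.2.trans hx.2⟩
      · exact ⟨hx.1.trans h.1.le, h.2.trans hxb⟩
    have hint : IntegrableOn
        (fun s => C ^ (k + 1) / k.factorial * |s - x₀| ^ k) (uIoc x₀ x) := by
      have : Continuous fun s : ℝ => C ^ (k + 1) / k.factorial * |s - x₀| ^ k := by fun_prop
      exact (this.intervalIntegrable x₀ x).def'
    have h1 : ‖peanoBaker M x₀ (k + 1) x‖ ≤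
        ∫ s in uIoc x₀ x, C ^ (k + 1) / k.factorial * |s - x₀| ^ k := by
      refine (intervalIntegral.norm_integral_le_integral_norm_uIoc).trans ?_
      have hcont : ContinuousOn (fun s => M s * peanoBaker M x₀ k s) (Ioi 0) :=
        hM.mul (peanoBaker_continuousOn M hx₀ hM k).1
      refine setIntegral_mono_on ?_ hint measurableSet_uIoc ?_
      · have : IntervalIntegrable (fun s => M s * peanoBaker M x₀ k s) volume x₀ x :=
          (hcont.mono fun t ht =>
            lt_of_lt_of_le (lt_min hx₀ (ha.trans_le hx.1)) ht.1).intervalIntegrable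
        exact this.def'.norm
      · intro s hs
        refine (norm_mul_le _ _).trans ?_
        have := mul_le_mul (hC s (hsub hs)) (ih s (hsub hs)) (norm_nonneg _) hC0
        refine this.trans (le_of_eq ?_)
        ring
    refine h1.trans (le_of_eq ?_)
    rw [integral_const_mul, integral_pow_abs_sub_uIoc, Nat.factorial_succ]
    have : (k.factorial : ℝ) ≠ 0 := by positivity
    push_cast
    field_simp

theorem hasDerivAt_tsum_peanoBaker (M : ℝ → E →L[ℝ] E) (hM : ContinuousOn M (Ioi 0))
    {x₀ x : ℝ} (hx₀ : 0 < x₀) (hx : 0 < x) :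
    HasDerivAt (fun x => ∑' k, peanoBaker M x₀ k x) (M x * ∑' k, peanoBaker M x₀ k x) x := by
  set a := min x₀ x / 2 with hadef
  set b := max x₀ x + 1 with hbdef
  have hmin : 0 < min x₀ x := lt_min hx₀ hx
  have ha : 0 < a := by positivity
  have hax₀ : a < x₀ := (half_lt_self hmin).trans_le (min_le_left _ _)
  have hax : a < x := (half_lt_self hmin).trans_le (min_le_right _ _)
  have hxb₀ : x₀ < b := by have := le_max_left x₀ x; linarith
  have hxb : x < b := by have := le_max_right x₀ x; linarith
  obtain ⟨C, hC⟩ := (isCompact_Icc (a := a) (b := b)).exists_bound_of_continuousOn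
    (hM.mono fun t ht => ha.trans_le ht.1)
  have hC0 : 0 ≤ C := (norm_nonneg _).trans (hC x₀ ⟨hax₀.le, hxb₀.le⟩)
  have hbd : ∀ k, ∀ y ∈ Ioo a b, ‖peanoBaker M x₀ k y‖ ≤
      (C * (b - a)) ^ k / k.factorial := by
    intro k y hy
    refine (peanoBaker_norm_le M hx₀ ha hax₀.le hxb₀.le hM hC k y ⟨hy.1.le, hy.2.le⟩).trans ?_
    rw [mul_pow]
    have : |y - x₀| ≤ b - a := by
      rw [abs_le]; constructor <;> linarith [hy.1, hy.2]
    gcongr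
  have hsum : Summable fun k : ℕ => (C * (b - a)) ^ k / k.factorial :=
    Real.summable_pow_div_factorial _
  have hsumx : Summable fun k => peanoBaker M x₀ k x :=
    Summable.of_norm_bounded hsum fun k => hbd k x ⟨hax, hxb⟩
  have hder := hasDerivAt_tsum_of_isPreconnected
    (g := fun k y => peanoBaker M x₀ (k + 1) y) (g' := fun k y => M y * peanoBaker M x₀ k y)
    (u := fun k => C * ((C * (b - a)) ^ k / k.factorial)) (t := Ioo a b) (y₀ := x) (y := x)
    (hsum.mul_left C) isOpen_Ioo isPreconnected_Ioo
    (fun k y hy => (peanoBaker_continuousOn M hx₀ hM k).2 y (ha.trans hy.1))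
    (fun k y hy => (norm_mul_le _ _).trans
      (mul_le_mul (hC y ⟨hy.1.le, hy.2.le⟩) (hbd k y hy) (norm_nonneg _) hC0))
    ⟨hax, hxb⟩ ((summable_nat_add_iff 1).2 hsumx) ⟨hax, hxb⟩
  rw [hsumx.tsum_mul_left] at hder
  have hloc : (fun y => ∑' k, peanoBaker M x₀ k y) =ᶠ[𝓝 x]
      fun y => 1 + ∑' k, peanoBaker M x₀ (k + 1) y := by
    filter_upwards [Ioo_mem_nhds hax hxb] with y hy
    exact (Summable.of_norm_bounded hsum fun k => hbd k y hy).tsum_eq_zero_add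
  exact (hder.const_add 1).congr_of_eventuallyEq hloc

/-- The evolution operator exists, whatever the continuous coefficient `B`. -/
theorem exists_evolution (A : E →L[ℝ] E) {B : ℝ → E →L[ℝ] E} (hB : ContinuousOn B (Ici 0))
    {x₀ : ℝ} (hx₀ : 0 < x₀) : ∃ Y, IsEvolutionOperator A B x₀ Y := by
  have hM : ContinuousOn (coeff A B) (Ioi 0) := by
    have hinv : ContinuousOn (fun x : ℝ => x⁻¹) (Ioi 0) :=
      continuousOn_inv₀.mono fun x hx => ne_of_gt hx
    exact (hinv.smul (continuousOn_const (c := A))).add (hB.mono Ioi_subset_Ici_self)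
  refine ⟨fun x => ∑' k, peanoBaker (coeff A B) x₀ k x, ?_,
    fun x hx => hasDerivAt_tsum_peanoBaker _ hM hx₀ hx⟩
  rw [tsum_eq_single 0]
  · rfl
  · intro k hk
    obtain ⟨j, rfl⟩ := Nat.exists_eq_succ_of_ne_zero hk
    simp [peanoBaker]

theorem evolution_spec (A : E →L[ℝ] E) {B : ℝ → E →L[ℝ] E} (hB : ContinuousOn B (Ici 0))
    {x₀ : ℝ} (hx₀ : 0 < x₀) : IsEvolutionOperator A B x₀ (evolution A B x₀) :=
  Classical.epsilon_spec (exists_evolution A hB hx₀)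

end Evolution

section Subspaces

variable {E : Type*} [NormedAddCommGroup E] [NormedSpace ℝ E]

/-- The system `y' = (A / x + B(x)) y` is exponentially dichotomic on `[a, ∞)`: for some projector
`P` the solutions starting in its range decay, and those starting in its kernel grow,
exponentially. -/
def IsExpDichotomic (A : E →L[ℝ] E) (B : ℝ → E →L[ℝ] E) (a : ℝ) : Prop :=
  ∃ P : E →L[ℝ] E, P * P = P ∧ ∃ K γ : ℝ, 0 < K ∧ 0 < γ ∧
    (∀ s x, a ≤ s → s ≤ x →
      ‖evolution A B a x * P * evolutionInv A B a s‖ ≤ K * Real.exp (-γ * (x - s))) ∧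
    (∀ s x, a ≤ x → x ≤ s →
      ‖evolution A B a x * (1 - P) * evolutionInv A B a s‖ ≤ K * Real.exp (-γ * (s - x)))

/-- The subspace `V₊` of those initial values at `x₀` whose solutions of the homogeneous system
are `O(x ^ (1 + α))` as `x → +0`, for some `α > 0`. -/
def spaceVPlus (A : E →L[ℝ] E) (B : ℝ → E →L[ℝ] E) (x₀ : ℝ) : Submodule ℝ E where
  carrier := {y₀ | ∃ α : ℝ, 0 < α ∧
    (fun x => evolution A B x₀ x y₀) =O[𝓝[>] 0] fun x : ℝ => x ^ (1 + α)}
  zero_mem' := ⟨1, one_pos, by simpa using isBigO_zero _ _⟩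
  add_mem' := by
    have mono : ∀ α β : ℝ, α ≤ β →
        (fun x : ℝ => x ^ (1 + β)) =O[𝓝[>] 0] fun x : ℝ => x ^ (1 + α) := by
      intro α β h
      refine IsBigO.of_bound 1 ?_
      filter_upwards [Ioo_mem_nhdsGT (zero_lt_one' ℝ)] with x hx
      rw [Real.norm_of_nonneg (Real.rpow_nonneg hx.1.le _),
        Real.norm_of_nonneg (Real.rpow_nonneg hx.1.le _), one_mul]
      exact Real.rpow_le_rpow_of_exponent_ge hx.1 hx.2.le (by linarith)
    rintro u v ⟨α, hα, hu⟩ ⟨β, hβ, hv⟩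
    refine ⟨min α β, lt_min hα hβ, ?_⟩
    simp only [map_add]
    exact (hu.trans (mono _ _ (min_le_left _ _))).add (hv.trans (mono _ _ (min_le_right _ _)))
  smul_mem' := by
    rintro c u ⟨α, hα, hu⟩
    refine ⟨α, hα, ?_⟩
    simp only [map_smul]
    exact hu.const_smul_left c

/-- The subspace `U₋` of those initial values at `x₀` whose solutions of the homogeneous system
are `O(exp (-γ x))` as `x → +∞`, for some `γ > 0`. -/
def spaceUMinus (A : E →L[ℝ] E) (B : ℝ → E →L[ℝ] E) (x₀ : ℝ) : Submodule ℝ E where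
  carrier := {y₀ | ∃ γ : ℝ, 0 < γ ∧
    (fun x => evolution A B x₀ x y₀) =O[atTop] fun x : ℝ => Real.exp (-γ * x)}
  zero_mem' := ⟨1, one_pos, by simpa using isBigO_zero _ _⟩
  add_mem' := by
    have mono : ∀ α β : ℝ, α ≤ β →
        (fun x : ℝ => Real.exp (-β * x)) =O[atTop] fun x : ℝ => Real.exp (-α * x) := by
      intro α β h
      refine IsBigO.of_bound 1 ?_
      filter_upwards [eventually_ge_atTop 0] with x hx
      rw [Real.norm_of_nonneg (Real.exp_pos _).le, Real.norm_of_nonneg (Real.exp_pos _).le, one_mul]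
      exact Real.exp_le_exp.2 (by nlinarith)
    rintro u v ⟨α, hα, hu⟩ ⟨β, hβ, hv⟩
    refine ⟨min α β, lt_min hα hβ, ?_⟩
    simp only [map_add]
    exact (hu.trans (mono _ _ (min_le_left _ _))).add (hv.trans (mono _ _ (min_le_right _ _)))
  smul_mem' := by
    rintro c u ⟨α, hα, hu⟩
    refine ⟨α, hα, ?_⟩
    simp only [map_smul]
    exact hu.const_smul_left c

/-- The subspace of those initial values at `x₀` whose solutions of the homogeneous system are
continuously differentiable on `[0, ∞)` (after extension to `x = 0`). -/
def spaceCOne (A : E →L[ℝ] E) (B : ℝ → E →L[ℝ] E) (x₀ : ℝ) : Submodule ℝ E where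
  carrier := {y₀ | ∃ z : ℝ → E, ContDiffOn ℝ 1 z (Ici 0) ∧ ∀ x, 0 < x → z x = evolution A B x₀ x y₀}
  zero_mem' := ⟨fun _ => 0, contDiffOn_const, by simp⟩
  add_mem' := by
    rintro u v ⟨z, hz, hzu⟩ ⟨w, hw, hwv⟩
    exact ⟨fun x => z x + w x, hz.add hw, fun x hx => by simp [hzu x hx, hwv x hx]⟩
  smul_mem' := by
    rintro c u ⟨z, hz, hzu⟩
    exact ⟨fun x => c • z x, contDiffOn_const.smul hz, fun x hx => by simp [hzu x hx]⟩

/-- `V0` is a choice of `V₋⁰`, and `L 0, …, L 5` is a choice of the subspaces `L₁, …, L₆`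
(in this order: `L i` is the subspace with number `i + 1`). -/
structure IsSplitting (A : E →L[ℝ] E) (B : ℝ → E →L[ℝ] E) (x₀ : ℝ)
    (V0 : Submodule ℝ E) (L : Fin 6 → Submodule ℝ E) : Prop where
  disjoint_V0 : Disjoint (spaceVPlus A B x₀) V0
  sup_V0 : spaceVPlus A B x₀ ⊔ V0 = spaceCOne A B x₀
  L1_eq : L 0 = spaceUMinus A B x₀ ⊓ spaceVPlus A B x₀
  disjoint_L2 : Disjoint (L 0) (L 1)
  sup_L2 : L 0 ⊔ L 1 = spaceUMinus A B x₀ ⊓ (spaceVPlus A B x₀ ⊔ V0)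
  disjoint_L3 : Disjoint (spaceUMinus A B x₀ ⊓ (spaceVPlus A B x₀ ⊔ V0)) (L 2)
  sup_L3 : (spaceUMinus A B x₀ ⊓ (spaceVPlus A B x₀ ⊔ V0)) ⊔ L 2 = spaceUMinus A B x₀
  disjoint_L4 : Disjoint (L 0) (L 3)
  sup_L4 : L 0 ⊔ L 3 = spaceVPlus A B x₀
  disjoint_L5 : Disjoint ((spaceUMinus A B x₀ ⊓ (spaceVPlus A B x₀ ⊔ V0)) ⊔ L 3) (L 4)
  sup_L5 : ((spaceUMinus A B x₀ ⊓ (spaceVPlus A B x₀ ⊔ V0)) ⊔ L 3) ⊔ L 4 = spaceVPlus A B x₀ ⊔ V0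
  L5_le : L 4 ≤ V0
  isCompl_L6 : IsCompl (spaceUMinus A B x₀ ⊔ L 3 ⊔ L 4) (L 5)

/-- The subspaces `L₁, …, L₆` form a direct sum decomposition of the whole space. -/
theorem IsSplitting.isCompl {A : E →L[ℝ] E} {B : ℝ → E →L[ℝ] E} {x₀ : ℝ}
    {V0 : Submodule ℝ E} {L : Fin 6 → Submodule ℝ E} (h : IsSplitting A B x₀ V0 L) (i : Fin 6) :
    IsCompl (L i) (⨆ j, ⨆ (_ : j ≠ i), L j) := by
  set U := spaceUMinus A B x₀
  set V := spaceVPlus A B x₀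
  have e3 : L 0 ⊔ L 1 ⊔ L 2 = U := by rw [h.sup_L2, h.sup_L3]
  have hL4 : L 3 ≤ V := le_sup_right.trans h.sup_L4.le
  have hL5 : L 4 ≤ V ⊔ V0 := h.L5_le.trans le_sup_right
  have d4 : Disjoint (L 3) U := by
    rw [Submodule.disjoint_def]
    intro x hx hxU
    have hx0 : x ∈ L 0 := by rw [h.L1_eq]; exact ⟨hxU, hL4 hx⟩
    exact Submodule.disjoint_def.1 h.disjoint_L4 x hx0 hx
  have d5 : Disjoint (L 4) (U ⊔ L 3) := by
    rw [Submodule.disjoint_def]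
    intro x hx hxs
    obtain ⟨u, hu, w, hw, rfl⟩ := Submodule.mem_sup.1 hxs
    have huC : u ∈ V ⊔ V0 := by
      have := Submodule.sub_mem _ (hL5 hx) (Submodule.mem_sup_left (T := V0) (hL4 hw))
      simpa using this
    exact Submodule.disjoint_def.1 h.disjoint_L5 _
      (Submodule.add_mem_sup ⟨hu, huC⟩ hw) hx
  have hind : iSupIndep L := by
    rw [iSupIndep_iff_supIndep_univ]
    have hu : (Finset.univ : Finset (Fin 6)) =
        insert 5 (insert 4 (insert 3 (insert 2 (insert 1 {0})))) := by decide
    rw [hu]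
    refine Finset.SupIndep.insert (Finset.SupIndep.insert (Finset.SupIndep.insert
      (Finset.SupIndep.insert (Finset.SupIndep.insert (Finset.supIndep_singleton _ _) ?_) ?_) ?_)
      ?_) ?_
    · simpa using h.disjoint_L2.symm
    · have := h.disjoint_L3.symm
      rw [← h.sup_L2] at this
      simpa [sup_comm, sup_left_comm, sup_assoc] using this
    · rw [← e3] at d4
      simpa [sup_comm, sup_left_comm, sup_assoc] using d4
    · rw [← e3] at d5
      simpa [sup_comm, sup_left_comm, sup_assoc] using d5
    · have : Disjoint (L 5) (U ⊔ L 3 ⊔ L 4) := h.isCompl_L6.disjoint.symm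
      rw [← e3] at this
      simpa [sup_comm, sup_left_comm, sup_assoc] using this
  refine ⟨hind i, ?_⟩
  rw [codisjoint_iff, eq_top_iff]
  have htop : ⨆ j, L j = ⊤ := by
    have ht : U ⊔ L 3 ⊔ L 4 ⊔ L 5 = ⊤ := h.isCompl_L6.sup_eq_top
    rw [eq_top_iff, ← ht, ← e3]
    simp only [sup_le_iff]
    exact ⟨⟨⟨⟨⟨le_iSup L 0, le_iSup L 1⟩, le_iSup L 2⟩, le_iSup L 3⟩, le_iSup L 4⟩, le_iSup L 5⟩
  rw [← htop]
  refine iSup_le fun j => ?_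
  by_cases hj : j = i
  · subst hj; exact le_sup_left
  · exact le_sup_of_le_right (le_iSup₂_of_le j hj le_rfl)

end Subspaces

section Green

variable {E : Type*} [NormedAddCommGroup E] [NormedSpace ℝ E] [FiniteDimensional ℝ E]

open Classical in
/-- The projectors `P₁, …, P₆` of the decomposition `E = L₁ ⊕ ⋯ ⊕ L₆` (again with `proj L i` the
projector with number `i + 1`): `proj L i` is the projector onto `L i` along the sum of the other
subspaces. The second branch does not occur for a splitting, see `IsSplitting.isCompl`. -/
noncomputable def proj (L : Fin 6 → Submodule ℝ E) (i : Fin 6) : E →L[ℝ] E :=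
  if h : IsCompl (L i) (⨆ j, ⨆ (_ : j ≠ i), L j) then
    LinearMap.toContinuousLinearMap ((L i).projection _ h)
  else 0

/-- `D = {(x, s) : 0 < x < s < x₀} ∪ {(x, s) : x₀ ≤ s ≤ x}`. -/
def setD (x₀ : ℝ) : Set (ℝ × ℝ) :=
  {p | 0 < p.1 ∧ p.1 < p.2 ∧ p.2 < x₀} ∪ {p | x₀ ≤ p.2 ∧ p.2 ≤ p.1}

/-- `D₊ = {(x, s) : 0 < s ≤ x}`. -/
def setDPlus : Set (ℝ × ℝ) := {p | 0 < p.2 ∧ p.2 ≤ p.1}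

/-- `D₋ = {(x, s) : 0 < x < s}`. -/
def setDMinus : Set (ℝ × ℝ) := {p | 0 < p.1 ∧ p.1 < p.2}

open Classical in
/-- The kernel `G₁(x, s)`. -/
noncomputable def green1 (A : E →L[ℝ] E) (B : ℝ → E →L[ℝ] E) (x₀ : ℝ)
    (L : Fin 6 → Submodule ℝ E) (x s : ℝ) : E →L[ℝ] E :=
  if (x, s) ∈ setD x₀ ∩ setDPlus then
    evolution A B x₀ x * proj L 0 * evolutionInv A B x₀ s
  else if (x, s) ∈ setD x₀ ∩ setDMinus then
    -(evolution A B x₀ x * proj L 0 * evolutionInv A B x₀ s)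
  else 0

open Classical in
/-- The kernel `G₂(x, s)`. -/
noncomputable def green2 (A : E →L[ℝ] E) (B : ℝ → E →L[ℝ] E) (x₀ : ℝ)
    (L : Fin 6 → Submodule ℝ E) (x s : ℝ) : E →L[ℝ] E :=
  if (x, s) ∈ setDPlus then
    evolution A B x₀ x * (proj L 1 + proj L 2) * evolutionInv A B x₀ s
  else if (x, s) ∈ setDMinus then
    -(evolution A B x₀ x * (proj L 3 + proj L 4 + proj L 5) * evolutionInv A B x₀ s)
  else 0

/-- The kernel `G(x, s) = G₁(x, s) + G₂(x, s)`. -/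
noncomputable def green (A : E →L[ℝ] E) (B : ℝ → E →L[ℝ] E) (x₀ : ℝ)
    (L : Fin 6 → Submodule ℝ E) (x s : ℝ) : E →L[ℝ] E :=
  green1 A B x₀ L x s + green2 A B x₀ L x s

end Green

/-- `y` is a solution of the boundary value problem `y' = (A / x + B(x)) y + g(x)` for `x > 0`,
`y ∈ C¹([0, ∞))`, `y(+0) = 0`, `y(+∞) = 0`. Values at negative arguments play no role. -/
structure IsBVPSolution {E : Type*} [NormedAddCommGroup E] [NormedSpace ℝ E]
    (A : E →L[ℝ] E) (B : ℝ → E →L[ℝ] E) (g : ℝ → E) (y : ℝ → E) : Prop where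
  contDiffOn : ContDiffOn ℝ 1 y (Ici 0)
  hasDerivAt : ∀ x, 0 < x → HasDerivAt y (coeff A B x (y x) + g x) x
  tendsto_zero : Tendsto y (𝓝[>] 0) (𝓝 0)
  tendsto_atTop : Tendsto y atTop (𝓝 0)

end SingularODE

/-!
Put `x = eᵗ` near `0`: for `u(t) = e⁻ᵗ y(eᵗ)` the system becomes
`u' = (A - 1 + eᵗ B(eᵗ)) u + g(eᵗ)`, where `A - 1` is hyperbolic and the perturbation vanishes
exponentially as `t → -∞`. Over `ℂ` the constant system is inverted on bounded functions one root
of the characteristic polynomial at a time, and a Neumann series absorbs the perturbation, so there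
are solutions of size `O(x)` near `0` for every bounded right-hand side. Testing these against
suitable right-hand sides shows that `Q Y⁻¹ g` is integrable at `0` as soon as `Q` vanishes on `V₊`.
If moreover `ker Q = V₊`, the solution with value `c` at `x₀` is `O(x)` exactly when
`Q c = ∫₀^{x₀} Q Y⁻¹ g`. The dichotomy gives in the same way, for `ker Q = U₋`, that the solution
tends to `0` at `∞` exactly when `Q c = -∫_{x₀}^∞ Q Y⁻¹ g`. The two conditions on `c` overlap in the
components along `L₅` and `L₆` only, and their compatibility there is (3).
-/

namespace SingularODE

section Evolution

variable {E : Type*} [NormedAddCommGroup E] [NormedSpace ℝ E]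

theorem continuousOn_coeff (A : E →L[ℝ] E) {B : ℝ → E →L[ℝ] E} (hB : ContinuousOn B (Ici 0)) :
    ContinuousOn (coeff A B) (Ioi 0) :=
  ((continuousOn_inv₀.mono fun _ hx => ne_of_gt hx).smul continuousOn_const).add
    (hB.mono Ioi_subset_Ici_self)

theorem eqOn_Ioi_of_hasDerivAt_clm {M : ℝ → E →L[ℝ] E} (hM : ContinuousOn M (Ioi 0))
    {u w : ℝ → E} (hu : ∀ x, 0 < x → HasDerivAt u (M x (u x)) x)
    (hw : ∀ x, 0 < x → HasDerivAt w (M x (w x)) x)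
    {x₁ : ℝ} (hx₁ : 0 < x₁) (h : u x₁ = w x₁) : EqOn u w (Ioi 0) := by
  rintro x (hx : 0 < x)
  obtain ⟨a, ha, ha_lt⟩ := exists_between (lt_min hx₁ hx)
  obtain ⟨b, hb_lt⟩ := exists_gt (max x₁ x)
  obtain ⟨C, hC⟩ := (isCompact_Icc (a := a) (b := b)).exists_bound_of_continuousOn
    (hM.mono fun t ht => ha.trans_le ht.1)
  refine ODE_solution_unique_of_mem_Ioo (v := fun t y => M t y) (s := fun _ => univ)
    (K := C.toNNReal) (a := a) (b := b) (t₀ := x₁) (fun t ht => ?_)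
    ⟨ha_lt.trans_le (min_le_left _ _), (le_max_left _ _).trans_lt hb_lt⟩
    (fun t ht => ⟨hu t (ha.trans ht.1), mem_univ _⟩)
    (fun t ht => ⟨hw t (ha.trans ht.1), mem_univ _⟩) h
    ⟨ha_lt.trans_le (min_le_right _ _), (le_max_right _ _).trans_lt hb_lt⟩
  refine ((M t).lipschitz.weaken ?_).lipschitzOnWith
  rw [← NNReal.coe_le_coe]
  exact (hC t ⟨ht.1.le, ht.2.le⟩).trans (Real.le_coe_toNNReal C)

omit [NormedSpace ℝ E] in
theorem intervalIntegrable_of_continuousOn_Ioi {f : ℝ → E} (hf : ContinuousOn f (Ioi 0)) {x y : ℝ}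
    (hx : 0 < x) (hy : 0 < y) : IntervalIntegrable f volume x y :=
  (hf.mono fun _ ht => (lt_min hx hy).trans_le ht.1).intervalIntegrable

/-- The solution of `y' = (A / x + B(x)) y + f(x)`, `y(x₀) = c`, as given by the variation of
constants formula. -/
noncomputable def variationOfConstants (A : E →L[ℝ] E) (B : ℝ → E →L[ℝ] E) (x₀ : ℝ) (f : ℝ → E)
    (c : E) (x : ℝ) : E :=
  evolution A B x₀ x (c + ∫ s in x₀..x, evolutionInv A B x₀ s (f s))

theorem variationOfConstants_add (A : E →L[ℝ] E) (B : ℝ → E →L[ℝ] E) (x₀ : ℝ) (f : ℝ → E)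
    (c v : E) (x : ℝ) :
    variationOfConstants A B x₀ f (c + v) x =
      variationOfConstants A B x₀ f c x + evolution A B x₀ x v := by
  rw [variationOfConstants, variationOfConstants, ← map_add, add_right_comm]

variable [CompleteSpace E]

theorem hasDerivAt_integral_of_continuousOn_Ioi {f : ℝ → E} (hf : ContinuousOn f (Ioi 0))
    {x₀ x : ℝ} (hx₀ : 0 < x₀) (hx : 0 < x) :
    HasDerivAt (fun x => ∫ s in x₀..x, f s) (f x) x :=
  intervalIntegral.integral_hasDerivAt_right (intervalIntegrable_of_continuousOn_Ioi hf hx₀ hx)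
    (hf.stronglyMeasurableAtFilter isOpen_Ioi x hx) (hf.continuousAt (Ioi_mem_nhds hx))

variable {A : E →L[ℝ] E} {B : ℝ → E →L[ℝ] E} (hB : ContinuousOn B (Ici 0)) {x₀ : ℝ} (hx₀ : 0 < x₀)
include hB hx₀

theorem evolution_self : evolution A B x₀ x₀ = 1 :=
  (evolution_spec A hB hx₀).apply_base

theorem hasDerivAt_evolution {x : ℝ} (hx : 0 < x) :
    HasDerivAt (evolution A B x₀) (coeff A B x * evolution A B x₀ x) x :=
  (evolution_spec A hB hx₀).hasDerivAt x hx

theorem hasDerivAt_evolution_apply (v : E) {x : ℝ} (hx : 0 < x) :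
    HasDerivAt (fun x => evolution A B x₀ x v) (coeff A B x (evolution A B x₀ x v)) x := by
  simpa using (hasDerivAt_evolution hB hx₀ hx (A := A)).clm_apply (hasDerivAt_const x v)

theorem evolution_mul_evolution {a x : ℝ} (ha : 0 < a) (hx : 0 < x) :
    evolution A B x₀ x * evolution A B a x₀ = evolution A B a x := by
  ext v
  refine eqOn_Ioi_of_hasDerivAt_clm (continuousOn_coeff A hB)
    (fun _ => hasDerivAt_evolution_apply hB hx₀ (evolution A B a x₀ v))
    (fun _ => hasDerivAt_evolution_apply hB ha v) hx₀ ?_ hx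
  simp [evolution_self hB hx₀]

theorem evolutionInv_eq_evolution {s : ℝ} (hs : 0 < s) :
    evolutionInv A B x₀ s = evolution A B s x₀ :=
  Ring.inverse_unit ⟨evolution A B x₀ s, evolution A B s x₀,
    (evolution_mul_evolution hB hx₀ hs hs).trans (evolution_self hB hs),
    (evolution_mul_evolution hB hs hx₀ hx₀).trans (evolution_self hB hx₀)⟩

theorem evolution_mul_evolutionInv {x : ℝ} (hx : 0 < x) :
    evolution A B x₀ x * evolutionInv A B x₀ x = 1 := by
  rw [evolutionInv_eq_evolution hB hx₀ hx, evolution_mul_evolution hB hx₀ hx hx,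
    evolution_self hB hx]

theorem evolutionInv_mul_evolution {x : ℝ} (hx : 0 < x) :
    evolutionInv A B x₀ x * evolution A B x₀ x = 1 := by
  rw [evolutionInv_eq_evolution hB hx₀ hx, evolution_mul_evolution hB hx hx₀ hx₀,
    evolution_self hB hx₀]

theorem evolution_evolutionInv_apply {x : ℝ} (hx : 0 < x) (v : E) :
    evolution A B x₀ x (evolutionInv A B x₀ x v) = v :=
  DFunLike.congr_fun (evolution_mul_evolutionInv hB hx₀ hx) v

theorem evolutionInv_evolution_apply {x : ℝ} (hx : 0 < x) (v : E) :
    evolutionInv A B x₀ x (evolution A B x₀ x v) = v :=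
  DFunLike.congr_fun (evolutionInv_mul_evolution hB hx₀ hx) v

theorem evolution_eq_mul_evolutionInv {a x : ℝ} (ha : 0 < a) (hx : 0 < x) :
    evolution A B a x = evolution A B x₀ x * evolutionInv A B x₀ a := by
  rw [evolutionInv_eq_evolution hB hx₀ ha, evolution_mul_evolution hB hx₀ ha hx]

theorem evolutionInv_eq_mul_evolutionInv {a x : ℝ} (ha : 0 < a) (hx : 0 < x) :
    evolutionInv A B a x = evolution A B x₀ a * evolutionInv A B x₀ x := by
  rw [evolutionInv_eq_evolution hB hx₀ hx, evolutionInv_eq_evolution hB ha hx,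
    evolution_mul_evolution hB hx₀ hx ha]

theorem hasDerivAt_evolutionInv {x : ℝ} (hx : 0 < x) :
    HasDerivAt (evolutionInv A B x₀) (-(evolutionInv A B x₀ x * coeff A B x)) x := by
  let u : (E →L[ℝ] E)ˣ := ⟨evolution A B x₀ x, evolutionInv A B x₀ x,
    evolution_mul_evolutionInv hB hx₀ hx, evolutionInv_mul_evolution hB hx₀ hx⟩
  refine ((hasFDerivAt_ringInverse (𝕜 := ℝ) u).comp_hasDerivAt x
    (hasDerivAt_evolution hB hx₀ hx)).congr_deriv ?_
  change -(evolutionInv A B x₀ x * (coeff A B x * evolution A B x₀ x) * evolutionInv A B x₀ x) = _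
  rw [mul_assoc, mul_assoc, evolution_mul_evolutionInv hB hx₀ hx, mul_one]

theorem continuousOn_evolutionInv : ContinuousOn (evolutionInv A B x₀) (Ioi 0) :=
  fun _ hx => (hasDerivAt_evolutionInv hB hx₀ hx).continuousAt.continuousWithinAt

section Variation

variable {f : ℝ → E} (hf : ContinuousOn f (Ioi 0))
include hf

theorem continuousOn_evolutionInv_apply :
    ContinuousOn (fun s => evolutionInv A B x₀ s (f s)) (Ioi 0) :=
  (continuousOn_evolutionInv hB hx₀).clm_apply hf

theorem intervalIntegrable_evolutionInv_apply {x y : ℝ} (hx : 0 < x) (hy : 0 < y) :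
    IntervalIntegrable (fun s => evolutionInv A B x₀ s (f s)) volume x y :=
  intervalIntegrable_of_continuousOn_Ioi (continuousOn_evolutionInv_apply hB hx₀ hf) hx hy

theorem intervalIntegrable_clm_evolutionInv {F : Type*} [NormedAddCommGroup F] [NormedSpace ℝ F]
    (Q : E →L[ℝ] F) {x y : ℝ} (hx : 0 < x) (hy : 0 < y) :
    IntervalIntegrable (fun s => Q (evolutionInv A B x₀ s (f s))) volume x y :=
  intervalIntegrable_of_continuousOn_Ioi
    (Q.continuous.comp_continuousOn (continuousOn_evolutionInv_apply hB hx₀ hf)) hx hy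

theorem hasDerivAt_variationOfConstants (c : E) {x : ℝ} (hx : 0 < x) :
    HasDerivAt (variationOfConstants A B x₀ f c)
      (coeff A B x (variationOfConstants A B x₀ f c x) + f x) x := by
  have hint := (hasDerivAt_integral_of_continuousOn_Ioi
    (continuousOn_evolutionInv_apply hB hx₀ hf (A := A)) hx₀ hx).const_add c
  refine ((hasDerivAt_evolution hB hx₀ hx).clm_apply hint).congr_deriv ?_
  rw [evolution_evolutionInv_apply hB hx₀ hx]
  rfl

theorem exists_eqOn_variationOfConstants {s : Set ℝ} (hs : IsOpen s) (hs' : IsPreconnected s)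
    (hs0 : s ⊆ Ioi 0) {y : ℝ → E} (hy : ∀ x ∈ s, HasDerivAt y (coeff A B x (y x) + f x) x) :
    ∃ c, EqOn y (variationOfConstants A B x₀ f c) s := by
  have hderiv : ∀ x ∈ s, HasDerivAt
      (fun x => evolutionInv A B x₀ x (y x) - ∫ s in x₀..x, evolutionInv A B x₀ s (f s)) 0 x := by
    intro x hx
    refine (((hasDerivAt_evolutionInv hB hx₀ (hs0 hx)).clm_apply (hy x hx)).sub
      (hasDerivAt_integral_of_continuousOn_Ioi (continuousOn_evolutionInv_apply hB hx₀ hf) hx₀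
        (hs0 hx))).congr_deriv ?_
    simp
  obtain ⟨c, hc⟩ := hs.exists_is_const_of_deriv_eq_zero hs'
    (fun x hx => (hderiv x hx).differentiableAt.differentiableWithinAt)
    (fun x hx => (hderiv x hx).deriv)
  refine ⟨c, fun x hx => ?_⟩
  rw [variationOfConstants, ← hc x hx, sub_add_cancel,
    evolution_evolutionInv_apply hB hx₀ (hs0 hx)]

theorem clm_evolutionInv_variationOfConstants {F : Type*} [NormedAddCommGroup F]
    [NormedSpace ℝ F] [CompleteSpace F] (Q : E →L[ℝ] F) (c : E) {x : ℝ} (hx : 0 < x) :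
    Q (evolutionInv A B x₀ x (variationOfConstants A B x₀ f c x)) =
      Q c + ∫ s in x₀..x, Q (evolutionInv A B x₀ s (f s)) := by
  rw [variationOfConstants, evolutionInv_evolution_apply hB hx₀ hx, map_add,
    Q.intervalIntegral_comp_comm (intervalIntegrable_evolutionInv_apply hB hx₀ hf hx₀ hx)]

theorem clm_evolutionInv_variationOfConstants_sub {F : Type*} [NormedAddCommGroup F]
    [NormedSpace ℝ F] [CompleteSpace F] (Q : E →L[ℝ] F) (c : E) {x z : ℝ} (hx : 0 < x)
    (hz : 0 < z) :
    Q (evolutionInv A B x₀ z (variationOfConstants A B x₀ f c z)) -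
      Q (evolutionInv A B x₀ x (variationOfConstants A B x₀ f c x)) =
      ∫ s in x..z, Q (evolutionInv A B x₀ s (f s)) := by
  rw [clm_evolutionInv_variationOfConstants hB hx₀ hf Q c hx,
    clm_evolutionInv_variationOfConstants hB hx₀ hf Q c hz, add_sub_add_left_eq_sub,
    intervalIntegral.integral_interval_sub_left
      (intervalIntegrable_clm_evolutionInv hB hx₀ hf Q hx₀ hz)
      (intervalIntegrable_clm_evolutionInv hB hx₀ hf Q hx₀ hx)]

theorem setIntegral_Ioc_clm_evolutionInv {F : Type*} [NormedAddCommGroup F] [NormedSpace ℝ F]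
    [CompleteSpace F] {Q : E →L[ℝ] F}
    (hQ : IntegrableOn (fun s => Q (evolutionInv A B x₀ s (f s))) (Ioc 0 x₀)) {x : ℝ}
    (hx : 0 < x) :
    ∫ s in Ioc 0 x, Q (evolutionInv A B x₀ s (f s)) =
      (∫ s in Ioc 0 x₀, Q (evolutionInv A B x₀ s (f s))) +
        Q (∫ s in x₀..x, evolutionInv A B x₀ s (f s)) := by
  rw [← Q.intervalIntegral_comp_comm (intervalIntegrable_evolutionInv_apply hB hx₀ hf hx₀ hx),
    ← intervalIntegral.integral_of_le hx.le, ← intervalIntegral.integral_of_le hx₀.le,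
    intervalIntegral.integral_add_adjacent_intervals
      ((intervalIntegrable_iff_integrableOn_Ioc_of_le hx₀.le).2 hQ)
      (intervalIntegrable_clm_evolutionInv hB hx₀ hf Q hx₀ hx)]

theorem setIntegral_Ioi_clm_evolutionInv {F : Type*} [NormedAddCommGroup F] [NormedSpace ℝ F]
    [CompleteSpace F] {Q : E →L[ℝ] F} {x : ℝ} (hx : 0 < x)
    (hQ : ∀ b, 0 < b → IntegrableOn (fun s => Q (evolutionInv A B x₀ s (f s))) (Ioi b)) :
    ∫ s in Ioi x, Q (evolutionInv A B x₀ s (f s)) =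
      (∫ s in Ioi x₀, Q (evolutionInv A B x₀ s (f s))) -
        Q (∫ s in x₀..x, evolutionInv A B x₀ s (f s)) := by
  rw [← Q.intervalIntegral_comp_comm (intervalIntegrable_evolutionInv_apply hB hx₀ hf hx₀ hx),
    ← intervalIntegral.integral_interval_add_Ioi (hQ x₀ hx₀) (hQ x hx), add_sub_cancel_left]

end Variation

end Evolution

section ScalarEquation

variable {F : Type*} [NormedAddCommGroup F] [NormedSpace ℂ F]

theorem hasDerivAt_cexp_mul_ofReal (μ : ℂ) (t : ℝ) :
    HasDerivAt (fun t : ℝ => Complex.exp (μ * t)) (μ * Complex.exp (μ * t)) t := by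
  simpa [mul_comm] using ((hasDerivAt_id t).ofReal_comp.const_mul μ).cexp

theorem norm_cexp_mul_ofReal (μ : ℂ) (t : ℝ) : ‖Complex.exp (μ * t)‖ = Real.exp (μ.re * t) := by
  simp [Complex.norm_exp]

theorem norm_le_of_hasDerivAt_of_re_neg {μ : ℂ} (hμ : μ.re < 0) {η r t : ℝ} (hrt : r ≤ t)
    {w h : ℝ → F} (hw : ∀ s ∈ Icc r t, HasDerivAt w (μ • w s + h s) s)
    (hh : ∀ s ∈ Icc r t, ‖h s‖ ≤ η) :
    ‖w t‖ ≤ Real.exp (μ.re * (t - r)) * ‖w r‖ + η / |μ.re| := by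
  set a := μ.re
  have hη : 0 ≤ η := (norm_nonneg _).trans (hh r ⟨le_rfl, hrt⟩)
  have hderiv : ∀ s ∈ Icc r t,
      HasDerivAt (fun s : ℝ => Complex.exp (-μ * s) • w s) (Complex.exp (-μ * s) • h s) s := by
    intro s hs
    refine ((hasDerivAt_cexp_mul_ofReal (-μ) s).smul (hw s hs)).congr_deriv ?_
    module
  have hbound : ∀ s, HasDerivAt
      (fun s => Real.exp (-a * r) * ‖w r‖ + η / |a| * (Real.exp (-a * s) - Real.exp (-a * r)))
      (Real.exp (-a * s) * η) s := by
    intro s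
    refine ((((hasDerivAt_id s).const_mul (-a)).exp.sub_const _).const_mul _ |>.const_add _
      ).congr_deriv ?_
    rw [abs_of_neg hμ]
    have := hμ.ne
    simp only [id, mul_one]
    field_simp
  have hexp : ‖Complex.exp (-μ * t) • w t‖ ≤
      Real.exp (-a * r) * ‖w r‖ + η / |a| * (Real.exp (-a * t) - Real.exp (-a * r)) := by
    refine image_norm_le_of_norm_deriv_right_le_deriv_boundary (a := r)
      (fun s hs => (hderiv s hs).continuousAt.continuousWithinAt)
      (fun s hs => (hderiv s (Ico_subset_Icc_self hs)).hasDerivWithinAt) ?_ hbound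
      (fun s hs => ?_) ⟨hrt, le_rfl⟩
    · rw [norm_smul, norm_cexp_mul_ofReal, sub_self, mul_zero, add_zero, Complex.neg_re]
    · rw [norm_smul, norm_cexp_mul_ofReal]
      exact mul_le_mul_of_nonneg_left (hh s (Ico_subset_Icc_self hs)) (Real.exp_pos _).le
  rw [norm_smul, norm_cexp_mul_ofReal] at hexp
  calc ‖w t‖ = Real.exp (a * t) * (Real.exp (-a * t) * ‖w t‖) := by
        rw [← mul_assoc, ← Real.exp_add]; simp
    _ ≤ Real.exp (a * t) * (Real.exp (-a * r) * ‖w r‖ + η / |a| * Real.exp (-a * t)) := by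
        gcongr
        refine hexp.trans ?_
        gcongr
        exact sub_le_self _ (Real.exp_pos _).le
    _ = Real.exp (a * (t - r)) * ‖w r‖ + η / |a| := by
        have hone : Real.exp (a * t) * Real.exp (-a * t) = 1 := by rw [← Real.exp_add]; simp
        rw [show a * (t - r) = a * t + -a * r by ring, Real.exp_add]
        linear_combination (η / |a|) * hone

theorem norm_le_of_hasDerivAt_of_re_pos {μ : ℂ} (hμ : 0 < μ.re) {η r t : ℝ} (hrt : r ≤ t)
    {w h : ℝ → F} (hw : ∀ s ∈ Icc r t, HasDerivAt w (μ • w s + h s) s)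
    (hh : ∀ s ∈ Icc r t, ‖h s‖ ≤ η) :
    ‖w r‖ ≤ Real.exp (μ.re * (r - t)) * ‖w t‖ + η / |μ.re| := by
  have hneg : ∀ s ∈ Icc (-t) (-r), -s ∈ Icc r t :=
    fun s hs => ⟨le_neg.1 hs.2, neg_le.1 hs.1⟩
  have hrev := norm_le_of_hasDerivAt_of_re_neg (μ := -μ) (by simpa using hμ) (neg_le_neg hrt)
    (w := fun s => w (-s)) (h := fun s => -h (-s)) (η := η)
    (fun s hs => ((hw _ (hneg s hs)).scomp s (hasDerivAt_neg s)).congr_deriv (by module))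
    (fun s hs => by simpa using hh _ (hneg s hs))
  convert hrev using 3 <;> simp
  ring

theorem tendsto_exp_mul_atBot {c : ℝ} (hc : 0 < c) :
    Tendsto (fun t : ℝ => Real.exp (c * t)) atBot (𝓝 0) :=
  Real.tendsto_exp_atBot.comp (tendsto_id.const_mul_atBot hc)

theorem exists_forall_Iic_hasDerivAt_and_norm_le {μ : ℂ} (hμ : μ.re ≠ 0) {w h : ℝ → F}
    (hw : ∀ᶠ t in atBot, HasDerivAt w (μ • w t + h t) t) (hh : Tendsto h atBot (𝓝 0))
    {ε : ℝ} (hε : 0 < ε) :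
    ∃ T, ∀ t ≤ T, HasDerivAt w (μ • w t + h t) t ∧ ‖h t‖ ≤ ε * |μ.re| := by
  have hsmall : ∀ᶠ t in atBot, ‖h t‖ ≤ ε * |μ.re| := by
    refine (tendsto_zero_iff_norm_tendsto_zero.1 hh).eventually_le_const ?_
    have := abs_pos.2 hμ
    positivity
  exact eventually_atBot.1 (hw.and hsmall)

theorem tendsto_zero_atBot_of_re_pos {μ : ℂ} (hμ : 0 < μ.re) {w h : ℝ → F}
    (hw : ∀ᶠ t in atBot, HasDerivAt w (μ • w t + h t) t) (hh : Tendsto h atBot (𝓝 0)) :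
    Tendsto w atBot (𝓝 0) := by
  rw [Metric.tendsto_nhds]
  intro ε hε
  obtain ⟨T, hT⟩ := exists_forall_Iic_hasDerivAt_and_norm_le hμ.ne' hw hh (half_pos hε)
  have hlim : Tendsto (fun t => Real.exp (μ.re * (t - T)) * ‖w T‖) atBot (𝓝 0) := by
    have := Real.tendsto_exp_atBot.comp
      ((tendsto_atBot_add_const_right atBot (-T) tendsto_id).const_mul_atBot hμ)
    simpa [sub_eq_add_neg] using this.mul_const ‖w T‖
  filter_upwards [hlim.eventually_lt_const (half_pos hε), eventually_le_atBot T] with t ht htT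
  have hle := norm_le_of_hasDerivAt_of_re_pos hμ htT (fun s hs => (hT s hs.2).1)
    (fun s hs => (hT s hs.2).2)
  rw [mul_div_cancel_right₀ _ (abs_pos.2 hμ.ne').ne'] at hle
  rw [dist_zero_right]
  linarith

theorem tendsto_zero_atBot_of_re_lt_neg {μ : ℂ} {β K : ℝ} (hβ : 0 ≤ β) (hμ : μ.re < -β)
    {w h : ℝ → F} (hw : ∀ᶠ t in atBot, HasDerivAt w (μ • w t + h t) t)
    (hK : ∀ᶠ t in atBot, ‖w t‖ ≤ K * Real.exp (-β * t)) (hh : Tendsto h atBot (𝓝 0)) :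
    Tendsto w atBot (𝓝 0) := by
  have hneg : μ.re < 0 := by linarith
  rw [Metric.tendsto_nhds]
  intro ε hε
  obtain ⟨T, hT⟩ := exists_forall_Iic_hasDerivAt_and_norm_le hneg.ne hw hh (half_pos hε)
  filter_upwards [eventually_le_atBot T] with t htT
  have hle : ∀ᶠ r in atBot,
      ‖w t‖ ≤ Real.exp (μ.re * t) * K * Real.exp (-(μ.re + β) * r) + ε / 2 := by
    filter_upwards [hK, eventually_le_atBot t] with r hr hrt
    have hle := norm_le_of_hasDerivAt_of_re_neg hneg hrt
      (fun s hs => (hT s (hs.2.trans htT)).1) (fun s hs => (hT s (hs.2.trans htT)).2)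
    rw [mul_div_cancel_right₀ _ (abs_pos.2 hneg.ne).ne'] at hle
    calc ‖w t‖ ≤ Real.exp (μ.re * (t - r)) * (K * Real.exp (-β * r)) + ε / 2 := by
          refine hle.trans ?_
          gcongr
      _ = _ := by
          rw [show μ.re * (t - r) = μ.re * t + -μ.re * r by ring,
            show -(μ.re + β) * r = -μ.re * r + -β * r by ring, Real.exp_add, Real.exp_add]
          ring
  have hlim := ((tendsto_exp_mul_atBot (c := -(μ.re + β)) (by linarith)).const_mul
    (Real.exp (μ.re * t) * K)).add_const (ε / 2)
  have := ge_of_tendsto hlim hle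
  rw [dist_zero_right]
  linarith

end ScalarEquation

section ConstantCoefficients

open BoundedContinuousFunction (ofNormedAddCommGroup norm_ofNormedAddCommGroup_le)
open scoped BoundedContinuousFunction Polynomial
open Polynomial (aeval C X)

variable {F : Type*} [NormedAddCommGroup F] [NormedSpace ℂ F]

theorem tendsto_zero_atBot_of_aeval_prod_tendsto_zero (N : F →L[ℂ] F) {β : ℝ} (hβ : 0 ≤ β)
    (m : Multiset ℂ) (hm : ∀ μ ∈ m, 0 < μ.re ∨ μ.re < -β) {z f : ℝ → F}
    (hz : ∀ᶠ t in atBot, HasDerivAt z (N (z t) + f t) t)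
    (hK : ∃ K, ∀ᶠ t in atBot, ‖z t‖ ≤ K * Real.exp (-β * t)) (hf : Tendsto f atBot (𝓝 0))
    (hprod : Tendsto (fun t => aeval N (m.map fun μ => X - C μ).prod (z t)) atBot (𝓝 0)) :
    Tendsto z atBot (𝓝 0) := by
  induction m using Multiset.induction generalizing z f with
  | empty => simpa using hprod
  | cons μ m ih =>
    set T : F →L[ℂ] F := N - algebraMap ℂ _ μ
    have hT (v : F) : N v = μ • v + T v := by simp [T, Algebra.algebraMap_eq_smul_one]
    obtain ⟨K, hK⟩ := hK
    have hw : Tendsto (fun t => T (z t)) atBot (𝓝 0) := by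
      refine ih (f := fun t => T (f t)) (fun ν hν => hm ν (Multiset.mem_cons_of_mem hν)) ?_
        ⟨‖T‖ * K, ?_⟩ (by simpa using! (T.continuous.tendsto 0).comp hf) ?_
      · filter_upwards [hz] with t ht
        refine ((T.restrictScalars ℝ).hasFDerivAt.comp_hasDerivAt t ht).congr_deriv ?_
        simp only [ContinuousLinearMap.coe_restrictScalars', map_add, hT, map_smul]
      · filter_upwards [hK] with t ht
        rw [mul_assoc]
        exact T.le_opNorm_of_le ht
      · refine hprod.congr fun t => ?_
        rw [Multiset.map_cons, Multiset.prod_cons, mul_comm, map_mul, map_sub, Polynomial.aeval_X,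
          Polynomial.aeval_C]
        rfl
    have hscalar : ∀ᶠ t in atBot, HasDerivAt z (μ • z t + (T (z t) + f t)) t := by
      filter_upwards [hz] with t ht
      rwa [hT, add_assoc] at ht
    have hrhs : Tendsto (fun t => T (z t) + f t) atBot (𝓝 0) := by simpa using hw.add hf
    rcases hm μ (Multiset.mem_cons_self μ m) with hμ | hμ
    · exact tendsto_zero_atBot_of_re_pos hμ hscalar hrhs
    · exact tendsto_zero_atBot_of_re_lt_neg hβ hμ hscalar hK hrhs

theorem integrableOn_Iic_cexp_neg_mul_smul {μ : ℂ} (hμ : μ.re < 0) (f : ℝ →ᵇ F) (t : ℝ) :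
    IntegrableOn (fun s : ℝ => Complex.exp (-μ * s) • f s) (Iic t) :=
  (((integrableOn_exp_mul_complex_Iic (a := -μ) (by simpa using hμ) t).norm.mul_const ‖f‖).mono'
    (by fun_prop) (ae_of_all _ fun s => by
      rw [norm_smul]
      exact mul_le_mul_of_nonneg_left (f.norm_coe_le_norm s) (norm_nonneg _)))

/-- The bounded solution of `w' = μ w + f` for bounded continuous `f`, when `Re μ < 0`. -/
noncomputable def boundedSolution (μ : ℂ) (f : ℝ →ᵇ F) (t : ℝ) : F :=
  Complex.exp (μ * t) • ∫ s in Iic t, Complex.exp (-μ * s) • f s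

theorem norm_boundedSolution_le {μ : ℂ} (hμ : μ.re < 0) (f : ℝ →ᵇ F) (t : ℝ) :
    ‖boundedSolution μ f t‖ ≤ (-μ.re)⁻¹ * ‖f‖ := by
  have hneg : 0 < -μ.re := neg_pos.2 hμ
  have hint : ‖∫ s in Iic t, Complex.exp (-μ * s) • f s‖ ≤
      ∫ s in Iic t, Real.exp (-μ.re * s) * ‖f‖ := by
    refine norm_integral_le_of_norm_le ((integrableOn_exp_mul_Iic hneg t).mul_const _)
      (ae_of_all _ fun s => ?_)
    rw [norm_smul, norm_cexp_mul_ofReal, Complex.neg_re]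
    exact mul_le_mul_of_nonneg_left (f.norm_coe_le_norm s) (Real.exp_pos _).le
  rw [integral_mul_const, integral_exp_mul_Iic hneg] at hint
  calc ‖boundedSolution μ f t‖
      ≤ Real.exp (μ.re * t) * (Real.exp (-μ.re * t) / -μ.re * ‖f‖) := by
        rw [boundedSolution, norm_smul, norm_cexp_mul_ofReal]
        gcongr
    _ = Real.exp (μ.re * t) * Real.exp (-μ.re * t) * ((-μ.re)⁻¹ * ‖f‖) := by ring
    _ = (-μ.re)⁻¹ * ‖f‖ := by rw [← Real.exp_add]; simp

section Complete

variable [CompleteSpace F]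

theorem hasDerivAt_boundedSolution {μ : ℂ} (hμ : μ.re < 0) (f : ℝ →ᵇ F) (t : ℝ) :
    HasDerivAt (boundedSolution μ f) (μ • boundedSolution μ f t + f t) t := by
  have hsplit : (fun t : ℝ => ∫ s in Iic t, Complex.exp (-μ * s) • f s) = fun t =>
      (∫ s in Iic (0 : ℝ), Complex.exp (-μ * s) • f s) +
        ∫ s in (0 : ℝ)..t, Complex.exp (-μ * s) • f s := by
    ext t
    rw [← intervalIntegral.integral_Iic_sub_Iic (integrableOn_Iic_cexp_neg_mul_smul hμ f 0)
      (integrableOn_Iic_cexp_neg_mul_smul hμ f t), add_sub_cancel]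
  have hcont : Continuous fun s : ℝ => Complex.exp (-μ * s) • f s := by fun_prop
  have hint : HasDerivAt (fun t : ℝ => ∫ s in Iic t, Complex.exp (-μ * s) • f s)
      (Complex.exp (-μ * t) • f t) t := by
    rw [hsplit]
    exact (hcont.integral_hasStrictDerivAt 0 t).hasDerivAt.const_add _
  refine ((hasDerivAt_cexp_mul_ofReal μ t).smul hint).congr_deriv ?_
  rw [smul_smul, ← Complex.exp_add, neg_mul, add_neg_cancel, Complex.exp_zero, one_smul, add_comm,
    mul_smul]
  rfl

theorem exists_resolvent_of_re_neg {μ : ℂ} (hμ : μ.re < 0) :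
    ∃ R : (ℝ →ᵇ F) →L[ℂ] (ℝ →ᵇ F),
      (∀ (T : F →L[ℂ] F) f, R (T.compLeftContinuousBounded ℝ f) =
        T.compLeftContinuousBounded ℝ (R f)) ∧
      ∀ f t, HasDerivAt (R f) (μ • R f t + f t) t := by
  refine ⟨LinearMap.mkContinuous
    { toFun := fun f => ofNormedAddCommGroup (boundedSolution μ f)
        (continuous_iff_continuousAt.2 fun t => (hasDerivAt_boundedSolution hμ f t).continuousAt)
        _ (norm_boundedSolution_le hμ f)
      map_add' := fun f g => ?_
      map_smul' := fun c f => ?_ }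
    (-μ.re)⁻¹ fun f => norm_ofNormedAddCommGroup_le _
      (mul_nonneg (inv_nonneg.2 (neg_pos.2 hμ).le) (norm_nonneg _)) (norm_boundedSolution_le hμ f),
    fun T f => ?_, hasDerivAt_boundedSolution hμ⟩
  · ext t
    have := integral_add (integrableOn_Iic_cexp_neg_mul_smul hμ f t)
      (integrableOn_Iic_cexp_neg_mul_smul hμ g t)
    simp_all [boundedSolution]
  · ext t
    simp [boundedSolution, integral_smul, smul_comm _ c]
  · ext t
    have := T.integral_comp_comm (integrableOn_Iic_cexp_neg_mul_smul hμ f t)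
    simp_all [boundedSolution]

theorem exists_resolvent {μ : ℂ} (hμ : μ.re ≠ 0) :
    ∃ R : (ℝ →ᵇ F) →L[ℂ] (ℝ →ᵇ F),
      (∀ (T : F →L[ℂ] F) f, R (T.compLeftContinuousBounded ℝ f) =
        T.compLeftContinuousBounded ℝ (R f)) ∧
      ∀ f t, HasDerivAt (R f) (μ • R f t + f t) t := by
  rcases hμ.lt_or_gt with hneg | hpos
  · exact exists_resolvent_of_re_neg hneg
  · obtain ⟨R, hRT, hR⟩ := exists_resolvent_of_re_neg (F := F) (μ := -μ) (by simpa using hpos)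
    let reflect :=
      BoundedContinuousFunction.compContinuousCLM F ℂ (⟨Neg.neg, continuous_neg⟩ : C(ℝ, ℝ))
    refine ⟨-(reflect ∘L R ∘L reflect), fun T f => ?_, fun f t => ?_⟩
    · have hcomm (f : ℝ →ᵇ F) : reflect (T.compLeftContinuousBounded ℝ f) =
          T.compLeftContinuousBounded ℝ (reflect f) := rfl
      simp [hcomm, hRT]
    · refine ((hR (reflect f) (-t)).scomp t (hasDerivAt_neg t)).neg.congr_deriv ?_
      simp [reflect, add_comm]

theorem exists_solutionOperator_of_aeval_prod_eq_zero (N : F →L[ℂ] F) (m : Multiset ℂ)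
    (hm : ∀ μ ∈ m, μ.re ≠ 0) :
    ∃ S : (ℝ →ᵇ F) →L[ℂ] (ℝ →ᵇ F), ∀ f : ℝ →ᵇ F,
      (∀ t, aeval N (m.map fun μ => X - C μ).prod (f t) = 0) →
        ∀ t, HasDerivAt (S f) (N (S f t) + f t) t := by
  induction m using Multiset.induction with
  | empty =>
    refine ⟨0, fun f hf t => ?_⟩
    have hzero : f t = 0 := by simpa using hf t
    simp [hzero]
  | cons μ m ih =>
    obtain ⟨S, hS⟩ := ih fun ν hν => hm ν (Multiset.mem_cons_of_mem hν)
    obtain ⟨R, hRT, hR⟩ := exists_resolvent (F := F) (hm μ (Multiset.mem_cons_self μ m))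
    set q : ℂ[X] := (m.map fun μ => X - C μ).prod
    set T : F →L[ℂ] F := N - algebraMap ℂ _ μ
    have hT (v : F) : N v = μ • v + T v := by simp [T, Algebra.algebraMap_eq_smul_one]
    refine ⟨R + S ∘L T.compLeftContinuousBounded ℝ ∘L R, fun f hf t => ?_⟩
    have hq : aeval N ((μ ::ₘ m).map fun μ => X - C μ).prod = aeval N q * T := by
      rw [Multiset.map_cons, Multiset.prod_cons, mul_comm, map_mul, map_sub, Polynomial.aeval_X,
        Polynomial.aeval_C]
    have hvanish : (aeval N q * T).compLeftContinuousBounded ℝ (R f) = 0 := by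
      rw [← hRT, ← hq, show ContinuousLinearMap.compLeftContinuousBounded ℝ _ f = 0 from
        DFunLike.ext _ _ hf, map_zero]
    refine ((hR f t).add (hS (T.compLeftContinuousBounded ℝ (R f))
      (fun t => DFunLike.congr_fun hvanish t) t)).congr_deriv ?_
    simp only [add_apply, ContinuousLinearMap.comp_apply, BoundedContinuousFunction.coe_add,
      Pi.add_apply, map_add, ContinuousLinearMap.compLeftContinuousBounded_apply, hT (R f t)]
    abel

end Complete

end ConstantCoefficients

section RealCoefficients

open scoped BoundedContinuousFunction Polynomial
open Polynomial (aeval C X)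

variable {E : Type*} [NormedAddCommGroup E] [NormedSpace ℝ E] [FiniteDimensional ℝ E]

theorem exists_complexification (N : E →L[ℝ] E) :
    ∃ (n : ℕ) (Nc : (Fin n → ℂ) →L[ℂ] (Fin n → ℂ)) (ι : E →L[ℝ] (Fin n → ℂ))
      (ρ : (Fin n → ℂ) →L[ℝ] E), (∀ v, ρ (ι v) = v) ∧ (∀ v, ι (N v) = Nc (ι v)) ∧
        (∀ w, ρ (Nc w) = N (ρ w)) ∧ aeval Nc (((LinearMap.charpoly (N : E →ₗ[ℝ] E)).aroots ℂ).map
          fun μ => X - C μ).prod = 0 := by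
  let b := Module.finBasis ℝ E
  let M := LinearMap.toMatrix b b (N : E →ₗ[ℝ] E)
  let Mc := Matrix.toLin' (M.map (algebraMap ℝ ℂ))
  let ι := Complex.ofRealAm.toLinearMap.compLeft (Fin _) ∘ₗ b.equivFun.toLinearMap
  let ρ := b.equivFun.symm.toLinearMap ∘ₗ Complex.reLm.compLeft (Fin _)
  have hM (v : E) : b.equivFun (N v) = M.mulVec (b.equivFun v) :=
    (LinearMap.toMatrix_mulVec_repr b b (N : E →ₗ[ℝ] E) v).symm
  have hMc (w i) : Mc w i = ∑ j, M i j * w j := by simp [Mc, Matrix.mulVec, dotProduct]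
  have hρ (w) : b.equivFun (ρ w) = fun i => (w i).re := b.equivFun.apply_symm_apply _
  refine ⟨_, Module.End.toContinuousLinearMap _ Mc, LinearMap.toContinuousLinearMap ι,
    LinearMap.toContinuousLinearMap ρ, fun v => ?_, fun v => ?_, fun w => ?_, ?_⟩
  · simp [ι, ρ]
  · ext i
    refine (congrArg ((↑) : ℝ → ℂ) (congrFun (hM v) i)).trans ((hMc _ i).trans ?_).symm
    simp [ι, Matrix.mulVec, dotProduct]
  · refine b.equivFun.injective ((?_ : b.equivFun (ρ (Mc w)) = _).trans (hM (ρ w)).symm)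
    ext i
    simp [hρ, hMc, Matrix.mulVec, dotProduct]
  · have hchar : (LinearMap.charpoly (N : E →ₗ[ℝ] E)).map (algebraMap ℝ ℂ) = Mc.charpoly := by
      rw [Matrix.charpoly_toLin', Matrix.charpoly_map, LinearMap.charpoly_toMatrix]
    rw [Polynomial.aroots, ← (IsAlgClosed.splits _).eq_prod_roots_of_monic
      ((LinearMap.charpoly_monic _).map _), hchar, Polynomial.aeval_algHom_apply,
      LinearMap.aeval_self_charpoly, map_zero]

theorem tendsto_zero_atBot_of_charpoly (N : E →L[ℝ] E) {β : ℝ} (hβ : 0 ≤ β)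
    (hN : ∀ μ : ℂ, aeval μ (LinearMap.charpoly (N : E →ₗ[ℝ] E)) = 0 → 0 < μ.re ∨ μ.re < -β)
    {z f : ℝ → E} (hz : ∀ᶠ t in atBot, HasDerivAt z (N (z t) + f t) t)
    (hK : ∃ K, ∀ᶠ t in atBot, ‖z t‖ ≤ K * Real.exp (-β * t)) (hf : Tendsto f atBot (𝓝 0)) :
    Tendsto z atBot (𝓝 0) := by
  obtain ⟨n, Nc, ι, ρ, hρι, hι, -, hprod⟩ := exists_complexification N
  obtain ⟨K, hK⟩ := hK
  have hιz : Tendsto (fun t => ι (z t)) atBot (𝓝 0) := by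
    refine tendsto_zero_atBot_of_aeval_prod_tendsto_zero Nc (f := fun t => ι (f t)) hβ _
      (fun μ hμ => hN μ (Polynomial.mem_aroots.1 hμ).2) ?_ ⟨‖ι‖ * K, ?_⟩
      (by simpa using! (ι.continuous.tendsto 0).comp hf) (by simp [hprod])
    · filter_upwards [hz] with t ht
      refine (ι.hasFDerivAt.comp_hasDerivAt t ht).congr_deriv ?_
      rw [map_add, hι]
    · filter_upwards [hK] with t ht
      rw [mul_assoc]
      exact ι.le_opNorm_of_le ht
  simpa [Function.comp_def, hρι] using! (ρ.continuous.tendsto 0).comp hιz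

theorem exists_solutionOperator_of_charpoly (N : E →L[ℝ] E)
    (hN : ∀ μ : ℂ, aeval μ (LinearMap.charpoly (N : E →ₗ[ℝ] E)) = 0 → μ.re ≠ 0) :
    ∃ S : (ℝ →ᵇ E) →L[ℝ] (ℝ →ᵇ E), ∀ f t, HasDerivAt (S f) (N (S f t) + f t) t := by
  obtain ⟨n, Nc, ι, ρ, hρι, -, hρ, hprod⟩ := exists_complexification N
  obtain ⟨S, hS⟩ := exists_solutionOperator_of_aeval_prod_eq_zero Nc _
    fun μ hμ => hN μ (Polynomial.mem_aroots.1 hμ).2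
  refine ⟨ρ.compLeftContinuousBounded ℝ ∘L S.restrictScalars ℝ ∘L ι.compLeftContinuousBounded ℝ,
    fun f t => ?_⟩
  refine (ρ.hasFDerivAt.comp_hasDerivAt t (hS (ι.compLeftContinuousBounded ℝ f)
    (fun t => by simp [hprod]) t)).congr_deriv ?_
  simp [hρ, hρι]

theorem aeval_charpoly_sub_smul_one (A : E →L[ℝ] E) (c : ℝ) (μ : ℂ) :
    aeval μ (LinearMap.charpoly ((A - c • 1 : E →L[ℝ] E) : E →ₗ[ℝ] E)) =
      aeval (μ + c) (LinearMap.charpoly (A : E →ₗ[ℝ] E)) := by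
  rw [show ((A - c • 1 : E →L[ℝ] E) : E →ₗ[ℝ] E) = (A : E →ₗ[ℝ] E) - c • 1 from rfl,
    LinearMap.charpoly_sub_smul, Polynomial.aeval_comp]
  simp

end RealCoefficients

section Perturbation

open BoundedContinuousFunction (ofNormedAddCommGroup norm_ofNormedAddCommGroup_le)
open scoped BoundedContinuousFunction

variable {E : Type*} [NormedAddCommGroup E] [NormedSpace ℝ E]

theorem exists_eq_apply_add_and_norm_le [CompleteSpace E] {T : E →L[ℝ] E} (hT : ‖T‖ < 1) (v : E) :
    ∃ u, u = T u + v ∧ ‖u‖ ≤ (1 - ‖T‖)⁻¹ * ‖v‖ := by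
  set u := (↑(Units.oneSub T hT)⁻¹ : E →L[ℝ] E) v
  have hu : u - T u = v := DFunLike.congr_fun (Units.mul_inv (Units.oneSub T hT)) v
  refine ⟨u, (add_eq_of_eq_sub' hu.symm).symm, ?_⟩
  rw [inv_mul_eq_div, le_div_iff₀ (sub_pos.2 hT)]
  calc ‖u‖ * (1 - ‖T‖) = ‖u‖ - ‖T‖ * ‖u‖ := by ring
    _ ≤ ‖u‖ - ‖T u‖ := sub_le_sub_left (T.le_opNorm u) _
    _ ≤ ‖u - T u‖ := norm_sub_norm_le _ _
    _ = ‖v‖ := by rw [hu]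

/-- Pointwise application of a bounded continuous family of operators, as an operator on bounded
continuous functions. -/
noncomputable def pointwiseApply (P : ℝ →ᵇ (E →L[ℝ] E)) : (ℝ →ᵇ E) →L[ℝ] (ℝ →ᵇ E) :=
  LinearMap.mkContinuous
    { toFun := fun f => ofNormedAddCommGroup (fun t => P t (f t))
        (P.continuous.clm_apply f.continuous) (‖P‖ * ‖f‖) fun t => (P t).le_of_opNorm_le_of_le
          (P.norm_coe_le_norm t) (f.norm_coe_le_norm t)
      map_add' := fun f g => by ext t; simp
      map_smul' := fun c f => by ext t; simp }
    ‖P‖ fun f => norm_ofNormedAddCommGroup_le _ (by positivity) fun t =>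
      (P t).le_of_opNorm_le_of_le (P.norm_coe_le_norm t) (f.norm_coe_le_norm t)

theorem norm_pointwiseApply_le (P : ℝ →ᵇ (E →L[ℝ] E)) : ‖pointwiseApply P‖ ≤ ‖P‖ :=
  LinearMap.mkContinuous_norm_le _ (norm_nonneg P) _

theorem exists_bounded_solution_of_norm_le [CompleteSpace E] {N : E →L[ℝ] E}
    (hN : ∃ S : (ℝ →ᵇ E) →L[ℝ] (ℝ →ᵇ E), ∀ f t, HasDerivAt (S f) (N (S f t) + f t) t) :
    ∃ ε > 0, ∃ K : ℝ, ∀ P : ℝ →ᵇ (E →L[ℝ] E), ‖P‖ ≤ ε → ∀ f : ℝ →ᵇ E, ∃ u : ℝ →ᵇ E,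
      ‖u‖ ≤ K * ‖f‖ ∧ ∀ t, HasDerivAt u (N (u t) + (P t (u t) + f t)) t := by
  obtain ⟨S, hS⟩ := hN
  refine ⟨(2 * (‖S‖ + 1))⁻¹, by positivity, 2 * ‖S‖, fun P hP f => ?_⟩
  set T := S ∘L pointwiseApply P
  have hT : ‖T‖ ≤ 1 / 2 := by
    calc ‖T‖ ≤ ‖S‖ * ‖pointwiseApply P‖ := ContinuousLinearMap.opNorm_comp_le _ _
      _ ≤ (‖S‖ + 1) * (2 * (‖S‖ + 1))⁻¹ := by
        gcongr
        · exact le_add_of_nonneg_right zero_le_one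
        · exact (norm_pointwiseApply_le P).trans hP
      _ = 1 / 2 := by field_simp
  obtain ⟨u, hu, hu_norm⟩ := exists_eq_apply_add_and_norm_le (hT.trans_lt one_half_lt_one) (S f)
  have hinv : (1 - ‖T‖)⁻¹ ≤ 2 := inv_le_of_inv_le₀ two_pos (by linarith)
  refine ⟨u, ?_, fun t => ?_⟩
  · calc ‖u‖ ≤ (1 - ‖T‖)⁻¹ * ‖S f‖ := hu_norm
      _ ≤ 2 * (‖S‖ * ‖f‖) := by
        gcongr
        exact S.le_opNorm f
      _ = 2 * ‖S‖ * ‖f‖ := (mul_assoc _ _ _).symm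
  · have hfix : u = S (pointwiseApply P u + f) := by rw [map_add]; exact hu
    have hderiv := hS (pointwiseApply P u + f) t
    rwa [← hfix] at hderiv

end Perturbation

section SingularAsymptotics

open Polynomial (aeval)

theorem exists_spectral_gap {q : Polynomial ℝ} (hq : q ≠ 0)
    (h : ∀ z : ℂ, aeval z q = 0 → z.re ≠ 1) :
    ∃ α : ℝ, 0 < α ∧ α < 1 ∧ ∀ z : ℂ, aeval z q = 0 → 1 + α < z.re ∨ z.re < 1 := by
  have hfin : (Complex.re '' {z : ℂ | aeval z q = 0}).Finite :=
    ((q.rootSet_finite ℂ).subset fun z hz => (Polynomial.mem_rootSet_of_ne hq).2 hz).image _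
  have hnhds : (Complex.re '' {z : ℂ | aeval z q = 0})ᶜ ∈ 𝓝 (1 : ℝ) := by
    refine hfin.isClosed.isOpen_compl.mem_nhds ?_
    rintro ⟨z, hz, hz1⟩
    exact h z hz hz1
  obtain ⟨ε, hε, hball⟩ := Metric.mem_nhds_iff.1 hnhds
  obtain ⟨α, hα, hα_lt⟩ := exists_between (lt_min hε one_pos)
  refine ⟨α, hα, hα_lt.trans_le (min_le_right _ _), fun z hz => ?_⟩
  by_contra! hcon
  refine hball (a := z.re) ?_ ⟨z, hz, rfl⟩
  have := min_le_left ε 1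
  rw [Metric.mem_ball, Real.dist_eq, abs_lt]
  constructor <;> linarith [hcon.1, hcon.2]

variable {E : Type*} [NormedAddCommGroup E] [NormedSpace ℝ E]

theorem isLittleO_rpow_nhdsGT_zero_iff {u : ℝ → E} {c : ℝ} :
    (u =o[𝓝[>] 0] fun x => x ^ c) ↔
      Tendsto (fun t => Real.exp (-c * t) • u (Real.exp t)) atBot (𝓝 0) := by
  rw [← Real.map_exp_atBot, isLittleO_map, ← isLittleO_one_iff ℝ, isLittleO_iff, isLittleO_iff]
  refine forall₂_congr fun ε _ => eventually_congr (Eventually.of_forall fun t => ?_)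
  rw [norm_smul, neg_mul, Real.exp_neg, norm_inv, Real.norm_of_nonneg (Real.exp_pos _).le,
    inv_mul_le_iff₀ (Real.exp_pos _)]
  simp [← Real.exp_mul, mul_comm]

theorem rpow_isLittleO_rpow_nhdsGT_zero {a b : ℝ} (hab : a < b) :
    (fun x : ℝ => x ^ b) =o[𝓝[>] 0] fun x : ℝ => x ^ a := by
  refine isLittleO_rpow_nhdsGT_zero_iff.2
    ((tendsto_exp_mul_atBot (sub_pos.2 hab)).congr fun t => ?_)
  rw [← Real.exp_mul, smul_eq_mul, ← Real.exp_add]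
  ring_nf

omit [NormedSpace ℝ E] in
theorem isBigO_rpow_nhdsGT_zero_iff {u : ℝ → E} {c : ℝ} :
    (u =O[𝓝[>] 0] fun x => x ^ c) ↔
      ∃ K, ∀ᶠ t in atBot, ‖u (Real.exp t)‖ ≤ K * Real.exp (c * t) := by
  rw [← Real.map_exp_atBot, isBigO_map, isBigO_iff]
  refine exists_congr fun K => eventually_congr (Eventually.of_forall fun t => ?_)
  simp [← Real.exp_mul, mul_comm t c]

theorem hasDerivAt_exp_substitution {A : E →L[ℝ] E} {y : ℝ → E} {v : E} (c t : ℝ)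
    (h : HasDerivAt y ((Real.exp t)⁻¹ • A (y (Real.exp t)) + v) (Real.exp t)) :
    HasDerivAt (fun t => Real.exp (-c * t) • y (Real.exp t))
      ((A - c • 1) (Real.exp (-c * t) • y (Real.exp t)) + Real.exp (-(c - 1) * t) • v) t := by
  have hexp : HasDerivAt (fun s => Real.exp (-c * s)) (-c * Real.exp (-c * t)) t := by
    simpa [mul_comm] using ((hasDerivAt_id t).const_mul (-c)).exp
  refine (hexp.smul (h.scomp t (Real.hasDerivAt_exp t))).congr_deriv ?_
  have hsplit : Real.exp (-(c - 1) * t) = Real.exp (-c * t) * Real.exp t := by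
    rw [← Real.exp_add]; ring_nf
  have : Real.exp t ≠ 0 := (Real.exp_pos t).ne'
  simp only [hsplit, sub_apply, smul_apply, one_apply_eq_self, map_smul, smul_add, smul_smul,
    Function.comp_apply]
  match_scalars <;> field_simp

variable [FiniteDimensional ℝ E]

theorem isLittleO_rpow_of_hasDerivAt {A : E →L[ℝ] E} {c β : ℝ} (hβ : 0 ≤ β)
    (hA : ∀ μ : ℂ, aeval μ (LinearMap.charpoly (A : E →ₗ[ℝ] E)) = 0 → c < μ.re ∨ μ.re < c - β)
    {y f : ℝ → E} (hy : ∀ᶠ x in 𝓝[>] 0, HasDerivAt y (x⁻¹ • A (y x) + f x) x)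
    (hy_bigO : y =O[𝓝[>] 0] fun x => x ^ (c - β)) (hf : f =o[𝓝[>] 0] fun x => x ^ (c - 1)) :
    y =o[𝓝[>] 0] fun x => x ^ c := by
  rw [isLittleO_rpow_nhdsGT_zero_iff] at hf ⊢
  obtain ⟨K, hK⟩ := isBigO_rpow_nhdsGT_zero_iff.1 hy_bigO
  refine tendsto_zero_atBot_of_charpoly (A - c • 1) hβ (fun μ hμ => ?_)
    ((Real.tendsto_exp_atBot_nhdsGT.eventually hy).mono fun t ht =>
      hasDerivAt_exp_substitution c t ht) ⟨K, ?_⟩ hf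
  · rw [aeval_charpoly_sub_smul_one] at hμ
    have := hA _ hμ
    rw [Complex.add_re, Complex.ofReal_re] at this
    exact this.imp (by intro; linarith) (by intro; linarith)
  · filter_upwards [hK] with t ht
    rw [norm_smul, Real.norm_of_nonneg (Real.exp_pos _).le]
    calc Real.exp (-c * t) * ‖y (Real.exp t)‖
        ≤ Real.exp (-c * t) * (K * Real.exp ((c - β) * t)) := by gcongr
      _ = K * (Real.exp (-c * t) * Real.exp ((c - β) * t)) := by ring
      _ = K * Real.exp (-β * t) := by rw [← Real.exp_add]; ring_nf

end SingularAsymptotics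

section NearZero

open Polynomial (aeval)

theorem isBigO_clm_apply {E : Type*} [NormedAddCommGroup E] [NormedSpace ℝ E] {ι : Type*}
    {l : Filter ι} {B : ι → E →L[ℝ] E} {B₀ : E →L[ℝ] E} (hB : Tendsto B l (𝓝 B₀)) {y : ι → E}
    {k : ι → ℝ} (hy : y =O[l] k) : (fun x => B x (y x)) =O[l] k := by
  refine (IsBigO.of_norm_le fun x => (B x).le_opNorm (y x)).trans ?_
  simpa using (hB.isBigO_one ℝ).norm_left.mul hy.norm_left

theorem contDiffOn_Ici_of_tendsto_deriv {E : Type*} [NormedAddCommGroup E] [NormedSpace ℝ E]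
    {y y' : ℝ → E} {a : ℝ} {c : E} (hy : ∀ x, a < x → HasDerivAt y (y' x) x)
    (hya : ContinuousWithinAt y (Ioi a) a) (hy' : ContinuousOn y' (Ioi a))
    (hc : Tendsto y' (𝓝[>] a) (𝓝 c)) : ContDiffOn ℝ 1 y (Ici a) := by
  have hderiv : ∀ x ∈ Ici a, HasDerivWithinAt y (Function.update y' a c x) (Ici a) x := by
    intro x hx
    rcases (mem_Ici.1 hx).eq_or_lt with rfl | hax
    · rw [Function.update_self]
      refine hasDerivWithinAt_Ici_of_tendsto_deriv
        (fun x hx => (hy x hx).differentiableAt.differentiableWithinAt) hya self_mem_nhdsWithin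
        (hc.congr' ?_)
      filter_upwards [self_mem_nhdsWithin] with x hx using (hy x hx).deriv.symm
    · rw [Function.update_of_ne hax.ne']
      exact (hy x hax).hasDerivWithinAt
  rw [contDiffOn_one_iff_derivWithin (uniqueDiffOn_Ici a)]
  refine ⟨fun x hx => (hderiv x hx).differentiableWithinAt, ?_⟩
  refine ContinuousOn.congr ?_ fun x hx => (hderiv x hx).derivWithin (uniqueDiffOn_Ici a x hx)
  rw [continuousOn_update_iff, Ici_sdiff_left]
  exact ⟨hy', fun _ => hc⟩

theorem isBigO_id_of_contDiffOn_Ici {E : Type*} [NormedAddCommGroup E] [NormedSpace ℝ E]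
    {y : ℝ → E} (hy : ContDiffOn ℝ 1 y (Ici 0)) (h0 : Tendsto y (𝓝[>] 0) (𝓝 0)) :
    y 0 = 0 ∧ y =O[𝓝[>] 0] fun x : ℝ => x := by
  have hle : 𝓝[>] (0 : ℝ) ≤ 𝓝[≥] 0 := nhdsWithin_mono _ Ioi_subset_Ici_self
  have hy0 : y 0 = 0 :=
    tendsto_nhds_unique ((hy.continuousOn 0 self_mem_Ici).mono_left hle) h0
  refine ⟨hy0, ?_⟩
  simpa [hy0] using (hy.differentiableOn one_ne_zero 0 self_mem_Ici).isBigO_sub.mono hle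

variable {E : Type*} [NormedAddCommGroup E] [NormedSpace ℝ E] [FiniteDimensional ℝ E]
  {A : E →L[ℝ] E} {B : ℝ → E →L[ℝ] E}

theorem surjective_sub_one_of_charpoly
    (hA : ∀ z : ℂ, aeval z (LinearMap.charpoly (A : E →ₗ[ℝ] E)) = 0 → z.re ≠ 1) :
    Function.Surjective (A - (1 : ℝ) • 1 : E →L[ℝ] E) := by
  have hspec : (1 : ℝ) ∉ spectrum ℝ (A : E →ₗ[ℝ] E) := by
    rw [Module.End.mem_spectrum_iff_isRoot_charpoly]
    intro hroot
    refine hA (algebraMap ℝ ℂ 1) ?_ (by simp)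
    rw [Polynomial.aeval_algebraMap_apply_eq_algebraMap_eval, hroot.eq_zero, map_zero]
  rw [spectrum.notMem_iff, Module.End.isUnit_iff] at hspec
  intro v
  obtain ⟨w, hw⟩ := hspec.surjective (-v)
  exact ⟨w, neg_injective (by simpa using hw)⟩

variable (hB : ContinuousOn B (Ici 0))
  (hA : ∀ z : ℂ, aeval z (LinearMap.charpoly (A : E →ₗ[ℝ] E)) = 0 → z.re ≠ 1)
  {x₀ : ℝ} (hx₀ : 0 < x₀)
include hB hA

theorem exists_tendsto_deriv_of_isBigO {g y : ℝ → E} {g₀ : E} (hg : Tendsto g (𝓝[>] 0) (𝓝 g₀))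
    (hy : ∀ᶠ x in 𝓝[>] 0, HasDerivAt y (coeff A B x (y x) + g x) x)
    (h : y =O[𝓝[>] 0] fun x => x) :
    ∃ c, Tendsto (fun x => coeff A B x (y x) + g x) (𝓝[>] 0) (𝓝 c) := by
  have hB₀ : Tendsto B (𝓝[>] 0) (𝓝 (B 0)) :=
    (hB 0 self_mem_Ici).mono_left (nhdsWithin_mono _ Ioi_subset_Ici_self)
  have hBy : Tendsto (fun x => B x (y x)) (𝓝[>] 0) (𝓝 0) :=
    (isBigO_clm_apply hB₀ h).trans_tendsto (tendsto_id.mono_left nhdsWithin_le_nhds)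
  -- `x • c` solves the equation with `B = 0` and `g = g₀`.
  obtain ⟨c, hc⟩ : ∃ c, A c + g₀ = c := by
    obtain ⟨c, hc⟩ := surjective_sub_one_of_charpoly hA (-g₀)
    exact ⟨c, sub_eq_zero.1 (by rw [add_sub_right_comm]; simpa [add_eq_zero_iff_eq_neg] using hc)⟩
  have hsub : (fun x => y x - x • c) =o[𝓝[>] 0] fun x : ℝ => x := by
    have := isLittleO_rpow_of_hasDerivAt (A := A) (c := 1) (β := 0) le_rfl
      (fun μ hμ => by simpa using (lt_or_gt_of_ne (hA μ hμ)).symm) (y := fun x => y x - x • c)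
      (f := fun x => B x (y x) + (g x - g₀)) ?_ ?_ ?_
    · simpa using this
    · filter_upwards [hy, self_mem_nhdsWithin] with x hx hx0
      refine (hx.sub ((hasDerivAt_id x).smul_const c)).congr_deriv ?_
      have : x⁻¹ * x = 1 := inv_mul_cancel₀ (ne_of_gt hx0)
      simp only [coeff, add_apply, smul_apply, map_sub, map_smul, smul_sub, smul_smul, this,
        one_smul, eq_sub_of_add_eq hc]
      abel
    · have hxc : (fun x : ℝ => x • c) =O[𝓝[>] 0] fun x : ℝ => x := by
        simpa using (isBigO_refl (fun x : ℝ => x) _).smul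
          (isBigO_const_const c (one_ne_zero (α := ℝ)) _)
      simpa using h.sub hxc
    · simpa using hBy.add (hg.sub_const g₀)
  have hquot : Tendsto (fun x => x⁻¹ • y x) (𝓝[>] 0) (𝓝 c) := by
    have := hsub.tendsto_inv_smul_nhds_zero.add_const c
    rw [zero_add] at this
    refine this.congr' ?_
    filter_upwards [self_mem_nhdsWithin] with x hx
    rw [smul_sub, inv_smul_smul₀ (ne_of_gt hx), sub_add_cancel]
  exact ⟨A c + 0 + g₀, by
    simpa [coeff] using (((A.continuous.tendsto c).comp hquot).add hBy).add hg⟩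

theorem contDiffOn_of_isBigO {g y : ℝ → E} (hg : ContinuousOn g (Ici 0))
    (hy : ∀ x, 0 < x → HasDerivAt y (coeff A B x (y x) + g x) x) (hy0 : y 0 = 0)
    (h : y =O[𝓝[>] 0] fun x : ℝ => x) : ContDiffOn ℝ 1 y (Ici 0) := by
  obtain ⟨c, hc⟩ := exists_tendsto_deriv_of_isBigO hB hA
    ((hg 0 self_mem_Ici).mono_left (nhdsWithin_mono _ Ioi_subset_Ici_self))
    (eventually_mem_nhdsWithin.mono hy) h
  refine contDiffOn_Ici_of_tendsto_deriv hy ?_ ?_ hc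
  · rw [ContinuousWithinAt, hy0]
    exact h.trans_tendsto (tendsto_id.mono_left nhdsWithin_le_nhds)
  · exact ((continuousOn_coeff A hB).clm_apply fun x hx =>
      (hy x hx).continuousAt.continuousWithinAt).add (hg.mono Ioi_subset_Ici_self)

include hx₀

theorem mem_spaceVPlus_iff_isBigO {v : E} :
    v ∈ spaceVPlus A B x₀ ↔ (fun x => evolution A B x₀ x v) =O[𝓝[>] 0] fun x => x := by
  have := FiniteDimensional.complete ℝ E
  constructor
  · rintro ⟨α, hα, h⟩
    simpa using h.trans (rpow_isLittleO_rpow_nhdsGT_zero (lt_add_of_pos_right 1 hα)).isBigO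
  · intro h
    obtain ⟨α, hα, hα1, hgap⟩ := exists_spectral_gap (LinearMap.charpoly_monic _).ne_zero hA
    have hB₀ : Tendsto B (𝓝[>] 0) (𝓝 (B 0)) :=
      (hB 0 self_mem_Ici).mono_left (nhdsWithin_mono _ Ioi_subset_Ici_self)
    refine ⟨α, hα, (isLittleO_rpow_of_hasDerivAt (A := A) hα.le (by simpa using hgap)
      (f := fun x => B x (evolution A B x₀ x v)) ?_ (by simpa using h) ?_).isBigO⟩
    · filter_upwards [self_mem_nhdsWithin] with x hx
      simpa [coeff] using hasDerivAt_evolution_apply hB hx₀ v hx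
    · have hx_rpow : (fun x : ℝ => x) =o[𝓝[>] 0] fun x => x ^ α := by
        simpa using rpow_isLittleO_rpow_nhdsGT_zero hα1
      simpa using (isBigO_clm_apply hB₀ h).trans_isLittleO hx_rpow

end NearZero

section BoundedSolutions

variable {F : Type*} [NormedAddCommGroup F]

open BoundedContinuousFunction in
theorem exists_boundedContinuousFunction_comp_log {h : ℝ → F} {b m : ℝ} (hb : 0 < b)
    (hh : ContinuousOn h (Ioc 0 b)) (hm : ∀ x ∈ Ioc 0 b, ‖h x‖ ≤ m) :
    ∃ H : ℝ →ᵇ F, ‖H‖ ≤ m ∧ ∀ x ∈ Ioc 0 b, H (Real.log x) = h x := by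
  set τ : ℝ → ℝ := fun t => Real.exp (min t (Real.log b))
  have hτ : ∀ t, τ t ∈ Ioc 0 b := fun t => ⟨Real.exp_pos _, by
    simpa [Real.exp_log hb] using Real.exp_le_exp.2 (min_le_right t (Real.log b))⟩
  refine ⟨ofNormedAddCommGroup (fun t => h (τ t)) (hh.comp_continuous (by fun_prop) hτ) m
    fun t => hm _ (hτ t), norm_ofNormedAddCommGroup_le _
      ((norm_nonneg _).trans (hm b ⟨hb, le_rfl⟩)) _, fun x hx => ?_⟩
  have : τ (Real.log x) = x := by
    simp only [τ]
    rw [min_eq_left (Real.log_le_log hx.1 hx.2), Real.exp_log hx.1]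
  exact congrArg h this

theorem exists_norm_le_of_isBigO_one {f : ℝ → F} (hf : ContinuousOn f (Ioi 0))
    (hf₀ : f =O[𝓝[>] 0] fun _ => (1 : ℝ)) (b : ℝ) : ∃ m, ∀ x ∈ Ioc 0 b, ‖f x‖ ≤ m := by
  obtain ⟨K, hK⟩ := hf₀.bound
  obtain ⟨ε, hε, hKε⟩ := mem_nhdsGT_iff_exists_Ioc_subset.1 hK
  obtain ⟨m, hm⟩ := (isCompact_Icc (a := ε) (b := b)).exists_bound_of_continuousOn
    (hf.mono fun x hx => hε.trans_le hx.1)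
  refine ⟨max K m, fun x hx => ?_⟩
  rcases le_total x ε with hxε | hxε
  · exact le_max_of_le_left (by simpa using hKε ⟨hx.1, hxε⟩)
  · exact le_max_of_le_right (hm x ⟨hxε, hx.2⟩)

end BoundedSolutions

section SingularIntegrals

theorem exists_approximate_sign {r : ℝ → ℝ} (hr : ContinuousOn r (Ioi 0)) {ρ : ℝ} (hρ : 0 < ρ) :
    ∃ φ : ℝ → ℝ, ContinuousOn φ (Ioi 0) ∧ (∀ s, 0 < s → |φ s| ≤ 1) ∧
      (∀ s ∈ Ioc 0 (ρ / 2), φ s = 0) ∧ (∀ s, 0 < s → 0 ≤ φ s * r s) ∧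
      ∀ s, ρ ≤ s → |r s| ≤ 1 + 2 * (φ s * r s) := by
  have hsign_mul : ∀ s, r s / (|r s| + 1) * r s = r s ^ 2 / (|r s| + 1) := fun s => by ring
  refine ⟨fun s => max 0 (1 - ρ / 2 / s) * (r s / (|r s| + 1)), ?_, fun s hs => ?_, fun s hs => ?_,
    fun s _ => ?_, fun s hs => ?_⟩
  · have hcut : ContinuousOn (fun s : ℝ => 1 - ρ / 2 / s) (Ioi 0) :=
      continuousOn_const.sub (continuousOn_const.div continuousOn_id fun s hs => ne_of_gt hs)
    exact (continuousOn_const.sup hcut).mul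
      (hr.div (hr.abs.add continuousOn_const) fun s _ => by positivity)
  · rw [abs_mul, abs_div, abs_of_pos (by positivity : 0 < |r s| + 1)]
    refine mul_le_one₀ ?_ (by positivity) ((div_le_one (by positivity)).2 (by linarith))
    rw [abs_of_nonneg (le_max_left _ _)]
    exact max_le zero_le_one (sub_le_self _ (by positivity))
  · have : 1 - ρ / 2 / s ≤ 0 := sub_nonpos.2 ((one_le_div hs.1).2 hs.2)
    simp [max_eq_left this]
  · rw [mul_assoc, hsign_mul]
    exact mul_nonneg (le_max_left _ _) (by positivity)
  · have hcut : 1 / 2 ≤ max 0 (1 - ρ / 2 / s) := by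
      have : ρ / 2 / s ≤ 1 / 2 := by
        rw [div_div, div_le_div_iff₀ (by linarith) two_pos]
        linarith
      exact le_max_of_le_right (by linarith)
    have hquot : |r s| - 1 ≤ r s ^ 2 / (|r s| + 1) := by
      rw [le_div_iff₀ (by positivity), ← sq_abs]
      linarith
    have : 0 ≤ r s ^ 2 / (|r s| + 1) := by positivity
    rw [mul_assoc, hsign_mul]
    nlinarith

theorem integrableOn_Ioc_of_forall_integral_mul_le {r : ℝ → ℝ} (hr : ContinuousOn r (Ioi 0))
    {b C : ℝ} (hb : 0 < b)
    (h : ∀ φ : ℝ → ℝ, ContinuousOn φ (Ioi 0) → (∀ s, 0 < s → |φ s| ≤ 1) → ∀ ρ ∈ Ioc 0 b,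
      (∀ s ∈ Ioc 0 ρ, φ s = 0) → ∫ s in ρ..b, φ s * r s ≤ C) :
    IntegrableOn r (Ioc 0 b) := by
  have hbound : ∀ ρ ∈ Ioc 0 b, ∫ s in ρ..b, |r s| ≤ b + 2 * C := by
    intro ρ hρ
    have hρ2 : 0 < ρ / 2 := half_pos hρ.1
    obtain ⟨φ, hφ, hφ_le, hφ_zero, hφr, hr_le⟩ := exists_approximate_sign hr hρ.1
    have hint : ∀ {x}, 0 < x → IntervalIntegrable (fun s => φ s * r s) volume x b := fun hx =>
      intervalIntegrable_of_continuousOn_Ioi (hφ.mul hr) hx hb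
    calc ∫ s in ρ..b, |r s|
        ≤ ∫ s in ρ..b, (1 + 2 * (φ s * r s)) :=
          intervalIntegral.integral_mono_on hρ.2
            (intervalIntegrable_of_continuousOn_Ioi hr.abs hρ.1 hb)
            (intervalIntegrable_const.add ((hint hρ.1).const_mul 2)) fun s hs => hr_le s hs.1
      _ = (b - ρ) + 2 * ∫ s in ρ..b, φ s * r s := by
          rw [intervalIntegral.integral_add intervalIntegrable_const ((hint hρ.1).const_mul 2)]
          simp
      _ ≤ (b - ρ) + 2 * ∫ s in ρ / 2..b, φ s * r s := by
          gcongr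
          exact intervalIntegral.integral_mono_interval (half_le_self hρ.1.le) hρ.2 le_rfl
            ((ae_restrict_mem measurableSet_Ioc).mono fun s hs => hφr s (hρ2.trans hs.1))
            (hint hρ2)
      _ ≤ b + 2 * C := by
          have := h φ hφ hφ_le (ρ / 2) ⟨hρ2, (half_le_self hρ.1.le).trans hρ.2⟩ hφ_zero
          linarith [hρ.1]
  have hpow : ∀ n : ℕ, b * (1 / 2) ^ n ∈ Ioc 0 b := fun n =>
    ⟨by positivity, mul_le_of_le_one_right hb.le (pow_le_one₀ (by norm_num) (by norm_num))⟩
  refine integrableOn_Ioc_of_intervalIntegral_norm_bounded_left (l := atTop)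
    (a := fun n : ℕ => b * (1 / 2) ^ n) (I := b + 2 * C) (fun n => ?_) ?_
    (Eventually.of_forall fun n => ?_)
  · exact (intervalIntegrable_of_continuousOn_Ioi hr (hpow n).1 hb).1
  · simpa using (tendsto_pow_atTop_nhds_zero_of_lt_one (r := (1 / 2 : ℝ)) (by norm_num)
      (by norm_num)).const_mul b
  · rw [← intervalIntegral.integral_of_le (hpow n).2]
    exact hbound _ (hpow n)

variable {E : Type*} [NormedAddCommGroup E] [NormedSpace ℝ E]

theorem eq_zero_of_tendsto_of_integrableOn_inv_smul {r : ℝ → E} {L : E} {b : ℝ} (hb : 0 < b)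
    (hr : Tendsto r (𝓝[>] 0) (𝓝 L)) (hint : IntegrableOn (fun x => x⁻¹ • r x) (Ioc 0 b)) :
    L = 0 := by
  by_contra hL
  have hpos : 0 < ‖L‖ := norm_pos_iff.2 hL
  have hev : ∀ᶠ x in 𝓝[>] (0 : ℝ), x⁻¹ ≤ 2 / ‖L‖ * ‖x⁻¹ • r x‖ ∧ x ≤ b := by
    filter_upwards [hr.norm.eventually (lt_mem_nhds (half_lt_self hpos)), Ioo_mem_nhdsGT hb]
      with x hrx hx
    refine ⟨?_, hx.2.le⟩
    have := inv_pos.2 hx.1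
    rw [norm_smul, Real.norm_of_nonneg this.le, div_mul_eq_mul_div, le_div_iff₀ hpos]
    nlinarith
  obtain ⟨δ, hδ, hδ_sub⟩ := mem_nhdsGT_iff_exists_Ioc_subset.1 hev
  have hinv : IntegrableOn (fun x : ℝ => x⁻¹) (Ioc 0 δ) := by
    refine ((hint.mono_set (Ioc_subset_Ioc_right (hδ_sub ⟨hδ, le_rfl⟩).2)).norm.const_mul
      (2 / ‖L‖)).mono' measurable_inv.aestronglyMeasurable ?_
    refine (ae_restrict_mem measurableSet_Ioc).mono fun x hx => ?_
    rw [Real.norm_of_nonneg (inv_nonneg.2 hx.1.le)]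
    exact (hδ_sub hx).1
  rcases intervalIntegrable_inv_iff.1
    ((intervalIntegrable_iff_integrableOn_Ioc_of_le (le_of_lt hδ)).2 hinv) with h | h
  · exact (ne_of_lt hδ) h
  · exact h left_mem_uIcc

theorem tendsto_integral_left_nhdsGT {f : ℝ → E} {a b : ℝ} (hab : a < b)
    (hf : IntegrableOn f (Ioc a b)) :
    Tendsto (fun x => ∫ s in x..b, f s) (𝓝[>] a) (𝓝 (∫ s in Ioc a b, f s)) := by
  rw [← intervalIntegral.integral_of_le hab.le]
  have hcont : ContinuousOn (fun x => ∫ s in x..b, f s) (uIcc a b) :=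
    intervalIntegral.continuousOn_primitive_interval_left
      (by rwa [uIcc_of_le hab.le, integrableOn_Icc_iff_integrableOn_Ioc])
  refine (hcont a left_mem_uIcc).mono_left ?_
  rw [uIcc_of_le hab.le, nhdsWithin_Icc_eq_nhdsGE hab]
  exact nhdsWithin_mono _ Ioi_subset_Ici_self

end SingularIntegrals

section ProjectionNearZero

open Polynomial (aeval)

variable {E : Type*} [NormedAddCommGroup E] [NormedSpace ℝ E] [FiniteDimensional ℝ E]
  {A : E →L[ℝ] E} {B : ℝ → E →L[ℝ] E} (hB : ContinuousOn B (Ici 0))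
  (hA : ∀ z : ℂ, aeval z (LinearMap.charpoly (A : E →ₗ[ℝ] E)) = 0 → z.re ≠ 1)
  {x₀ : ℝ} (hx₀ : 0 < x₀)
include hB hA

theorem exists_solution_norm_le_mul_self :
    ∃ δ > 0, ∃ K, ∀ (f : ℝ → E) (m : ℝ), ContinuousOn f (Ioi 0) → (∀ x ∈ Ioc 0 δ, ‖f x‖ ≤ m) →
      ∃ y, ∀ x ∈ Ioo 0 δ, HasDerivAt y (coeff A B x (y x) + f x) x ∧ ‖y x‖ ≤ K * m * x := by
  have := FiniteDimensional.complete ℝ E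
  obtain ⟨ε, hε, K, hK⟩ := exists_bounded_solution_of_norm_le (N := A - (1 : ℝ) • 1)
    (exists_solutionOperator_of_charpoly _ fun μ hμ => by
      rw [aeval_charpoly_sub_smul_one] at hμ
      simpa [add_eq_right] using hA _ hμ)
  have hcont : ContinuousOn (fun x : ℝ => x • B x) (Ici 0) := continuousOn_id.smul hB
  have hxB : Tendsto (fun x : ℝ => x • B x) (𝓝[>] 0) (𝓝 0) := by
    simpa using (hcont 0 self_mem_Ici).tendsto.mono_left (nhdsWithin_mono _ Ioi_subset_Ici_self)
  obtain ⟨δ, hδ, hδε⟩ := mem_nhdsGT_iff_exists_Ioc_subset.1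
    (hxB.norm.eventually (ge_mem_nhds (by simpa using hε)))
  obtain ⟨P, hP, hPB⟩ := exists_boundedContinuousFunction_comp_log hδ
    (hcont.mono fun x hx => hx.1.le) fun x hx => hδε hx
  refine ⟨δ, hδ, |K|, fun f m hf hfm => ?_⟩
  obtain ⟨F, hF, hFf⟩ := exists_boundedContinuousFunction_comp_log hδ
    (hf.mono Ioc_subset_Ioi_self) hfm
  obtain ⟨u, hu, hu_deriv⟩ := hK P hP F
  refine ⟨fun x => x • u (Real.log x), fun x hx => ⟨?_, ?_⟩⟩
  · refine ((hasDerivAt_id x).smul ((hu_deriv (Real.log x)).scomp x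
      (Real.hasDerivAt_log hx.1.ne'))).congr_deriv ?_
    have : x ≠ 0 := hx.1.ne'
    simp only [coeff, hPB x (Ioo_subset_Ioc_self hx), hFf x (Ioo_subset_Ioc_self hx), add_apply,
      smul_apply, sub_apply, one_apply_eq_self, map_smul, id, Function.comp_apply]
    match_scalars <;> field_simp
    ring
  · rw [norm_smul, Real.norm_of_nonneg hx.1.le, mul_comm]
    refine mul_le_mul_of_nonneg_right ((u.norm_coe_le_norm _).trans (hu.trans ?_)) hx.1.le
    gcongr
    exact le_abs_self K

include hx₀

theorem exists_norm_variationOfConstants_le :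
    ∃ δ > 0, ∃ K, ∀ (f : ℝ → E) (m : ℝ), ContinuousOn f (Ioi 0) → (∀ x ∈ Ioc 0 δ, ‖f x‖ ≤ m) →
      ∃ c, ∀ x ∈ Ioc 0 δ, ‖variationOfConstants A B x₀ f c x‖ ≤ K * m * x := by
  have := FiniteDimensional.complete ℝ E
  obtain ⟨δ, hδ, K, hK⟩ := exists_solution_norm_le_mul_self hB hA
  refine ⟨δ, hδ, K, fun f m hf hfm => ?_⟩
  obtain ⟨y, hy⟩ := hK f m hf hfm
  obtain ⟨c, hc⟩ := exists_eqOn_variationOfConstants hB hx₀ hf isOpen_Ioo isPreconnected_Ioo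
    (fun x hx => hx.1) fun x hx => (hy x hx).1
  refine ⟨c, fun x hx => ?_⟩
  have hx' : x ∈ closure (Ioo 0 δ) := by
    rw [closure_Ioo hδ.ne]
    exact Ioc_subset_Icc_self hx
  refine ContinuousWithinAt.closure_le hx' (f := fun z => ‖variationOfConstants A B x₀ f c z‖)
    (g := fun z => K * m * z) ?_ (by fun_prop) fun z hz => ?_
  · exact (hasDerivAt_variationOfConstants hB hx₀ hf c hx.1).continuousAt.continuousWithinAt.norm
  · rw [← hc hz]
    exact (hy z hz).2

theorem exists_abs_integral_clm_evolutionInv_le {ℓ : E →L[ℝ] ℝ}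
    (hℓ : ∀ v ∈ spaceVPlus A B x₀, ℓ v = 0) :
    ∃ δ > 0, ∃ C, ∀ (f : ℝ → E) (m : ℝ), ContinuousOn f (Ioi 0) → (∀ x ∈ Ioc 0 δ, ‖f x‖ ≤ m) →
      ∀ ρ ∈ Ioc 0 δ, (∀ x ∈ Ioc 0 ρ, f x = 0) →
        |∫ s in ρ..δ, ℓ (evolutionInv A B x₀ s (f s))| ≤ C * m := by
  have := FiniteDimensional.complete ℝ E
  obtain ⟨δ, hδ, K, hK⟩ := exists_norm_variationOfConstants_le hB hA hx₀
  refine ⟨δ, hδ, ‖ℓ ∘L evolutionInv A B x₀ δ‖ * K * δ, fun f m hf hfm ρ hρ hfρ => ?_⟩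
  obtain ⟨c, hc⟩ := hK f m hf hfm
  set y := variationOfConstants A B x₀ f c
  -- On `(0, ρ]` the solution `y` solves the homogeneous system, so its initial value is in `V₊`.
  have hVPlus : evolutionInv A B x₀ ρ (y ρ) ∈ spaceVPlus A B x₀ := by
    rw [mem_spaceVPlus_iff_isBigO hB hA hx₀]
    refine IsBigO.of_bound (K * m) ?_
    filter_upwards [Ioc_mem_nhdsGT hρ.1] with x hx
    have hconst : evolutionInv A B x₀ x (y x) = evolutionInv A B x₀ ρ (y ρ) := by
      refine (sub_eq_zero.1 ((clm_evolutionInv_variationOfConstants_sub hB hx₀ hf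
        (ContinuousLinearMap.id ℝ E) c hx.1 hρ.1).trans ?_)).symm
      rw [intervalIntegral.integral_of_le hx.2]
      exact setIntegral_eq_zero_of_forall_eq_zero fun s hs => by
        simp [hfρ s ⟨hx.1.trans hs.1, hs.2⟩]
    rw [← hconst, evolution_evolutionInv_apply hB hx₀ hx.1, Real.norm_of_nonneg hx.1.le]
    exact hc x ⟨hx.1, hx.2.trans hρ.2⟩
  have hint : ∫ s in ρ..δ, ℓ (evolutionInv A B x₀ s (f s)) =
      (ℓ ∘L evolutionInv A B x₀ δ) (y δ) := by
    rw [← clm_evolutionInv_variationOfConstants_sub hB hx₀ hf ℓ c hρ.1 hδ, hℓ _ hVPlus, sub_zero,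
      ContinuousLinearMap.comp_apply]
  rw [hint, ← Real.norm_eq_abs]
  calc _ ≤ ‖ℓ ∘L evolutionInv A B x₀ δ‖ * (K * m * δ) :=
        (ℓ ∘L evolutionInv A B x₀ δ).le_opNorm_of_le (hc δ ⟨hδ, le_rfl⟩)
    _ = _ := by ring

theorem integrableOn_functional_evolutionInv {ℓ : E →L[ℝ] ℝ}
    (hℓ : ∀ v ∈ spaceVPlus A B x₀, ℓ v = 0) {f : ℝ → E} (hf : ContinuousOn f (Ioi 0))
    (hf₀ : f =O[𝓝[>] 0] fun _ => (1 : ℝ)) (b : ℝ) :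
    IntegrableOn (fun s => ℓ (evolutionInv A B x₀ s (f s))) (Ioc 0 b) := by
  have := FiniteDimensional.complete ℝ E
  obtain ⟨δ, hδ, C, hC⟩ := exists_abs_integral_clm_evolutionInv_le hB hA hx₀ hℓ
  obtain ⟨m, hm⟩ := exists_norm_le_of_isBigO_one hf hf₀ δ
  have hcont : ContinuousOn (fun s => ℓ (evolutionInv A B x₀ s (f s))) (Ioi 0) :=
    ℓ.continuous.comp_continuousOn (continuousOn_evolutionInv_apply hB hx₀ hf)
  have hnear : IntegrableOn (fun s => ℓ (evolutionInv A B x₀ s (f s))) (Ioc 0 δ) := by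
    refine integrableOn_Ioc_of_forall_integral_mul_le (C := C * m) hcont hδ
      fun φ hφ hφ_le ρ hρ hφ_zero => ?_
    refine (le_abs_self _).trans (le_of_eq_of_le ?_ (hC (fun s => φ s • f s) m (hφ.smul hf)
      (fun x hx => ?_) ρ hρ fun x hx => by simp [hφ_zero x hx]))
    · simp
    · rw [norm_smul]
      exact (mul_le_of_le_one_left (norm_nonneg _) (hφ_le x hx.1)).trans (hm x hx)
  have hfar := (intervalIntegrable_of_continuousOn_Ioi hcont hδ
    (lt_max_of_lt_right hδ : 0 < max b δ)).1
  refine (hnear.union hfar).mono_set ?_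
  rw [Ioc_union_Ioc_eq_Ioc hδ.le (le_max_right b δ)]
  exact Ioc_subset_Ioc_right (le_max_left b δ)

theorem integrableOn_clm_evolutionInv {Q : E →L[ℝ] E} (hQ : ∀ v ∈ spaceVPlus A B x₀, Q v = 0)
    {f : ℝ → E} (hf : ContinuousOn f (Ioi 0)) (hf₀ : f =O[𝓝[>] 0] fun _ => (1 : ℝ)) (b : ℝ) :
    IntegrableOn (fun s => Q (evolutionInv A B x₀ s (f s))) (Ioc 0 b) := by
  set e := (Module.finBasis ℝ E).equivFunL
  refine e.integrable_comp_iff.1 (Integrable.of_eval fun i => ?_)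
  exact integrableOn_functional_evolutionInv hB hA hx₀
    (ℓ := ContinuousLinearMap.proj i ∘L (e : E →L[ℝ] (Fin (Module.finrank ℝ E) → ℝ)) ∘L Q)
    (fun v hv => by simp [hQ v hv]) hf hf₀ b

theorem clm_eq_integral_of_isBigO {Q : E →L[ℝ] E} (hQ : ∀ v ∈ spaceVPlus A B x₀, Q v = 0)
    {f : ℝ → E} (hf : ContinuousOn f (Ioi 0)) (hf₀ : f =O[𝓝[>] 0] fun _ => (1 : ℝ)) {c : E}
    (h : variationOfConstants A B x₀ f c =O[𝓝[>] 0] fun x : ℝ => x) :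
    Q c = ∫ s in Ioc 0 x₀, Q (evolutionInv A B x₀ s (f s)) := by
  have := FiniteDimensional.complete ℝ E
  set y := variationOfConstants A B x₀ f c
  have hlim : Tendsto (fun x => Q (evolutionInv A B x₀ x (y x))) (𝓝[>] 0)
      (𝓝 (Q c - ∫ s in Ioc 0 x₀, Q (evolutionInv A B x₀ s (f s)))) := by
    refine ((tendsto_integral_left_nhdsGT hx₀
      (integrableOn_clm_evolutionInv hB hA hx₀ hQ hf hf₀ x₀)).const_sub (Q c)).congr' ?_
    filter_upwards [self_mem_nhdsWithin] with x hx
    rw [clm_evolutionInv_variationOfConstants hB hx₀ hf Q c hx, intervalIntegral.integral_symm,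
      sub_neg_eq_add]
  have hy_cont : ContinuousOn y (Ioi 0) := fun x hx =>
    (hasDerivAt_variationOfConstants hB hx₀ hf c hx).continuousAt.continuousWithinAt
  have hquot : (fun x => x⁻¹ • y x) =O[𝓝[>] 0] fun _ => (1 : ℝ) := by
    refine ((isBigO_refl (fun x : ℝ => x⁻¹) _).smul h).congr' EventuallyEq.rfl ?_
    filter_upwards [self_mem_nhdsWithin] with x hx using inv_mul_cancel₀ (ne_of_gt hx)
  refine sub_eq_zero.1 (eq_zero_of_tendsto_of_integrableOn_inv_smul hx₀ hlim ?_)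
  simpa using integrableOn_clm_evolutionInv hB hA hx₀ hQ
    ((continuousOn_inv₀.mono fun x hx => ne_of_gt hx).smul hy_cont) hquot x₀

theorem isBigO_variationOfConstants_iff {Q : E →L[ℝ] E}
    (hQ : ∀ v, Q v = 0 ↔ v ∈ spaceVPlus A B x₀)
    {f : ℝ → E} (hf : ContinuousOn f (Ioi 0)) (hf₀ : f =O[𝓝[>] 0] fun _ => (1 : ℝ)) {c : E} :
    (variationOfConstants A B x₀ f c =O[𝓝[>] 0] fun x : ℝ => x) ↔
      Q c = ∫ s in Ioc 0 x₀, Q (evolutionInv A B x₀ s (f s)) := by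
  refine ⟨clm_eq_integral_of_isBigO hB hA hx₀ (fun v => (hQ v).2) hf hf₀, fun h => ?_⟩
  obtain ⟨δ, hδ, K, hK⟩ := exists_norm_variationOfConstants_le hB hA hx₀
  obtain ⟨m, hm⟩ := exists_norm_le_of_isBigO_one hf hf₀ δ
  obtain ⟨c₁, hc₁⟩ := hK f m hf hm
  have hc₁_bigO : variationOfConstants A B x₀ f c₁ =O[𝓝[>] 0] fun x : ℝ => x := by
    refine IsBigO.of_bound (K * m) ?_
    filter_upwards [Ioc_mem_nhdsGT hδ] with x hx
    rw [Real.norm_of_nonneg hx.1.le]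
    exact hc₁ x hx
  have hdiff : c - c₁ ∈ spaceVPlus A B x₀ := by
    rw [← hQ, map_sub, h, clm_eq_integral_of_isBigO hB hA hx₀ (fun v => (hQ v).2) hf hf₀ hc₁_bigO,
      sub_self]
  rw [mem_spaceVPlus_iff_isBigO hB hA hx₀] at hdiff
  refine (hc₁_bigO.add hdiff).congr_left fun x => ?_
  rw [← variationOfConstants_add, add_sub_cancel]

end ProjectionNearZero

section NearInfinity

section ExponentialIntegrals

theorem exp_neg_mul_sub_eq_mul (γ x s : ℝ) :
    Real.exp (-γ * (s - x)) = Real.exp (γ * x) * Real.exp (-γ * s) := by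
  rw [← Real.exp_add]
  ring_nf

variable {γ : ℝ} (hγ : 0 < γ)
include hγ

theorem tendsto_exp_neg_mul_atTop : Tendsto (fun x => Real.exp (-γ * x)) atTop (𝓝 0) :=
  Real.tendsto_exp_atBot.comp (tendsto_id.const_mul_atTop_of_neg (neg_lt_zero.2 hγ))

theorem integral_exp_neg_mul_sub_le (r x : ℝ) : ∫ s in r..x, Real.exp (-γ * (x - s)) ≤ γ⁻¹ := by
  have hderiv : ∀ s, HasDerivAt (fun s => γ⁻¹ * Real.exp (-γ * (x - s)))
      (Real.exp (-γ * (x - s))) s := by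
    intro s
    refine (((((hasDerivAt_id s).const_sub x).const_mul (-γ)).exp).const_mul γ⁻¹).congr_deriv ?_
    simp only [id]
    field_simp
  have hcont : Continuous fun s => Real.exp (-γ * (x - s)) := by fun_prop
  rw [intervalIntegral.integral_eq_sub_of_hasDerivAt (fun s _ => hderiv s)
    (hcont.intervalIntegrable _ _), sub_self, mul_zero, Real.exp_zero, mul_one]
  exact sub_le_self _ (by positivity)

theorem integrableOn_exp_neg_mul_sub (x : ℝ) :
    IntegrableOn (fun s => Real.exp (-γ * (s - x))) (Ioi x) := by
  simp only [exp_neg_mul_sub_eq_mul γ x]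
  exact (integrableOn_exp_mul_Ioi (neg_lt_zero.2 hγ) x).const_mul _

theorem integral_Ioi_exp_neg_mul_sub (x : ℝ) :
    ∫ s in Ioi x, Real.exp (-γ * (s - x)) = γ⁻¹ := by
  simp only [exp_neg_mul_sub_eq_mul γ x]
  rw [integral_const_mul, integral_exp_mul_Ioi (neg_lt_zero.2 hγ), neg_div_neg_eq, ← mul_div_assoc,
    ← Real.exp_add]
  simp

end ExponentialIntegrals

variable {E : Type*} [NormedAddCommGroup E] [NormedSpace ℝ E]

/-- The evolution operator normalized at `x₀` has an exponential dichotomy on `[a, ∞)` with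
projection `P`, constant `K` and rate `γ`. In `IsExpDichotomic` the evolution operator is normalized
at `a` instead, which conjugates the projection. -/
structure HasExpDichotomy (A : E →L[ℝ] E) (B : ℝ → E →L[ℝ] E) (x₀ a : ℝ) (P : E →L[ℝ] E)
    (K γ : ℝ) : Prop where
  const_pos : 0 < K
  rate_pos : 0 < γ
  isIdempotentElem : IsIdempotentElem P
  norm_stable_le : ∀ s x, a ≤ s → s ≤ x →
    ‖evolution A B x₀ x * P * evolutionInv A B x₀ s‖ ≤ K * Real.exp (-γ * (x - s))
  norm_unstable_le : ∀ s x, a ≤ x → x ≤ s →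
    ‖evolution A B x₀ x * (1 - P) * evolutionInv A B x₀ s‖ ≤ K * Real.exp (-γ * (s - x))

theorem tendsto_zero_of_mem_spaceUMinus {A : E →L[ℝ] E} {B : ℝ → E →L[ℝ] E} {x₀ : ℝ} {v : E}
    (hv : v ∈ spaceUMinus A B x₀) : Tendsto (fun x => evolution A B x₀ x v) atTop (𝓝 0) := by
  obtain ⟨γ, hγ, h⟩ := hv
  exact h.trans_tendsto (tendsto_exp_neg_mul_atTop hγ)

section Estimates

variable {A : E →L[ℝ] E} {B : ℝ → E →L[ℝ] E} {x₀ a : ℝ} {P : E →L[ℝ] E} {K γ : ℝ}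
  (hP : HasExpDichotomy A B x₀ a P K γ) {f : ℝ → E}
include hP

theorem HasExpDichotomy.norm_integral_stable_le {ε r x : ℝ} (hr : a ≤ r) (hrx : r ≤ x)
    (hfε : ∀ s, r ≤ s → ‖f s‖ ≤ ε) :
    ‖∫ s in r..x, evolution A B x₀ x (P (evolutionInv A B x₀ s (f s)))‖ ≤ K * ε * γ⁻¹ := by
  have hε : 0 ≤ ε := (norm_nonneg _).trans (hfε r le_rfl)
  have hcont : Continuous fun s => K * ε * Real.exp (-γ * (x - s)) := by fun_prop
  calc _ ≤ ∫ s in r..x, K * ε * Real.exp (-γ * (x - s)) := by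
        refine intervalIntegral.norm_integral_le_of_norm_le hrx (ae_of_all _ fun s hs => ?_)
          (hcont.intervalIntegrable _ _)
        exact (ContinuousLinearMap.le_of_opNorm_le_of_le _
          (hP.norm_stable_le s x (hr.trans hs.1.le) hs.2) (hfε s hs.1.le)).trans_eq (by ring)
    _ ≤ _ := by
      rw [intervalIntegral.integral_const_mul]
      exact mul_le_mul_of_nonneg_left (integral_exp_neg_mul_sub_le hP.rate_pos r x)
        (mul_nonneg hP.const_pos.le hε)

theorem HasExpDichotomy.norm_integral_unstable_le {ε x : ℝ} (hx : a ≤ x)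
    (hfε : ∀ s, x ≤ s → ‖f s‖ ≤ ε) :
    ‖∫ s in Ioi x, evolution A B x₀ x ((1 - P) (evolutionInv A B x₀ s (f s)))‖ ≤
      K * ε * γ⁻¹ := by
  rw [← integral_Ioi_exp_neg_mul_sub hP.rate_pos x, ← integral_const_mul]
  refine norm_integral_le_of_norm_le ((integrableOn_exp_neg_mul_sub hP.rate_pos x).const_mul _)
    ((ae_restrict_mem measurableSet_Ioi).mono fun s (hs : x < s) => ?_)
  exact (ContinuousLinearMap.le_of_opNorm_le_of_le _ (hP.norm_unstable_le s x hx hs.le)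
    (hfε s hs.le)).trans_eq (by ring)

end Estimates

variable [CompleteSpace E] {A : E →L[ℝ] E} {B : ℝ → E →L[ℝ] E} (hB : ContinuousOn B (Ici 0))
  {x₀ : ℝ} (hx₀ : 0 < x₀) {a : ℝ} (ha : 0 < a)
include hB hx₀ ha

theorem exists_hasExpDichotomy (h : IsExpDichotomic A B a) :
    ∃ P K γ, HasExpDichotomy A B x₀ a P K γ := by
  obtain ⟨P, hP, K, γ, hK, hγ, hstable, hunstable⟩ := h
  have hinv := evolution_mul_evolutionInv hB hx₀ ha (A := A)
  have hconj : ∀ (R : E →L[ℝ] E) {x s : ℝ}, 0 < x → 0 < s →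
      evolution A B x₀ x * (evolutionInv A B x₀ a * R * evolution A B x₀ a) *
        evolutionInv A B x₀ s = evolution A B a x * R * evolutionInv A B a s := by
    intro R x s hx hs
    rw [evolution_eq_mul_evolutionInv hB hx₀ ha hx, evolutionInv_eq_mul_evolutionInv hB hx₀ ha hs]
    simp only [mul_assoc]
  refine ⟨evolutionInv A B x₀ a * P * evolution A B x₀ a, K, γ, hK, hγ, ?_, fun s x hs hx => ?_,
    fun s x hx hs => ?_⟩
  · calc _ = evolutionInv A B x₀ a * P * (evolution A B x₀ a * evolutionInv A B x₀ a) *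
          (P * evolution A B x₀ a) := by simp only [mul_assoc]
      _ = _ := by rw [hinv, mul_one, ← mul_assoc, mul_assoc _ P P, hP]
  · rw [hconj P (ha.trans_le (hs.trans hx)) (ha.trans_le hs)]
    exact hstable s x hs hx
  · have hcompl : 1 - evolutionInv A B x₀ a * P * evolution A B x₀ a =
        evolutionInv A B x₀ a * (1 - P) * evolution A B x₀ a := by
      rw [mul_sub, mul_one, sub_mul, evolutionInv_mul_evolution hB hx₀ ha]
    rw [hcompl, hconj (1 - P) (ha.trans_le hx) (ha.trans_le (hx.trans hs))]
    exact hunstable s x hx hs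

variable {P : E →L[ℝ] E} {K γ : ℝ} (hP : HasExpDichotomy A B x₀ a P K γ)
include hP

theorem HasExpDichotomy.apply_mem_spaceUMinus (v : E) : P v ∈ spaceUMinus A B x₀ := by
  refine ⟨γ, hP.rate_pos,
    IsBigO.of_bound (K * Real.exp (γ * a) * ‖evolution A B x₀ a v‖) ?_⟩
  filter_upwards [eventually_ge_atTop a] with x hx
  have hfactor : evolution A B x₀ x (P v) =
      (evolution A B x₀ x * P * evolutionInv A B x₀ a) (evolution A B x₀ a v) := by
    simp only [mul_apply_eq_comp, evolutionInv_evolution_apply hB hx₀ ha]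
  rw [hfactor, Real.norm_of_nonneg (Real.exp_pos _).le]
  refine (ContinuousLinearMap.le_of_opNorm_le _ (hP.norm_stable_le a x le_rfl hx) _).trans_eq ?_
  rw [exp_neg_mul_sub_eq_mul]
  ring

section Annihilator

variable {F : Type*} [NormedAddCommGroup F] [NormedSpace ℝ F] {Q : E →L[ℝ] F}
  (hQ : ∀ v, Q (P v) = 0)
include hQ

theorem HasExpDichotomy.norm_clm_evolutionInv_le :
    ∃ C, ∀ s, a ≤ s → ‖Q ∘L evolutionInv A B x₀ s‖ ≤ C * Real.exp (-γ * s) := by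
  refine ⟨‖Q ∘L evolutionInv A B x₀ a‖ * (K * Real.exp (γ * a)), fun s hs => ?_⟩
  have hfactor : Q ∘L evolutionInv A B x₀ s = (Q ∘L evolutionInv A B x₀ a) ∘L
      (evolution A B x₀ a * (1 - P) * evolutionInv A B x₀ s) := by
    ext v
    simp [evolutionInv_evolution_apply hB hx₀ ha, hQ]
  rw [hfactor]
  calc _ ≤ ‖Q ∘L evolutionInv A B x₀ a‖ * (K * Real.exp (-γ * (s - a))) :=
        (ContinuousLinearMap.opNorm_comp_le _ _).trans
          (mul_le_mul_of_nonneg_left (hP.norm_unstable_le s a le_rfl hs) (norm_nonneg _))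
    _ = _ := by
      rw [exp_neg_mul_sub_eq_mul]
      ring

theorem HasExpDichotomy.tendsto_clm_evolutionInv {y : ℝ → E} (hy : Tendsto y atTop (𝓝 0)) :
    Tendsto (fun x => Q (evolutionInv A B x₀ x (y x))) atTop (𝓝 0) := by
  obtain ⟨C, hC⟩ := hP.norm_clm_evolutionInv_le hB hx₀ ha hQ
  have hbound : Tendsto (fun x => C * Real.exp (-γ * x) * ‖y x‖) atTop (𝓝 0) := by
    simpa using ((tendsto_exp_neg_mul_atTop hP.rate_pos).const_mul C).mul hy.norm
  refine squeeze_zero_norm' ?_ hbound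
  filter_upwards [eventually_ge_atTop a] with x hx
  exact (Q ∘L evolutionInv A B x₀ x).le_of_opNorm_le (hC x hx) _

variable {f : ℝ → E} (hf : ContinuousOn f (Ioi 0)) (hf_lim : Tendsto f atTop (𝓝 0))
include hf hf_lim

theorem HasExpDichotomy.integrableOn_Ioi_clm_evolutionInv {b : ℝ} (hb : 0 < b) :
    IntegrableOn (fun s => Q (evolutionInv A B x₀ s (f s))) (Ioi b) := by
  obtain ⟨C, hC⟩ := hP.norm_clm_evolutionInv_le hB hx₀ ha hQ
  have hcont : ContinuousOn (fun s => Q (evolutionInv A B x₀ s (f s))) (Ici b) :=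
    (Q.continuous.comp_continuousOn (continuousOn_evolutionInv_apply hB hx₀ hf)).mono
      fun s hs => hb.trans_le hs
  refine (integrable_norm_iff ((hcont.mono Ioi_subset_Ici_self).aestronglyMeasurable
    measurableSet_Ioi)).1 (integrable_of_isBigO_exp_neg hP.rate_pos hcont.norm
      (IsBigO.of_bound C ?_))
  filter_upwards [eventually_ge_atTop a, hf_lim.norm.eventually_le_const
    (show ‖(0 : E)‖ < 1 by simp)] with s hs hfs
  rw [Real.norm_of_nonneg (Real.exp_pos _).le]
  simpa using (Q ∘L evolutionInv A B x₀ s).le_of_opNorm_le_of_le (hC s hs) hfs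

variable [CompleteSpace F]

theorem HasExpDichotomy.clm_eq_neg_integral_of_tendsto {c : E}
    (h : Tendsto (variationOfConstants A B x₀ f c) atTop (𝓝 0)) :
    Q c = -∫ s in Ioi x₀, Q (evolutionInv A B x₀ s (f s)) := by
  have hlim := (intervalIntegral_tendsto_integral_Ioi x₀
    (hP.integrableOn_Ioi_clm_evolutionInv hB hx₀ ha hQ hf hf_lim hx₀) tendsto_id).const_add (Q c)
  refine eq_neg_of_add_eq_zero_left (tendsto_nhds_unique hlim
    ((hP.tendsto_clm_evolutionInv hB hx₀ ha hQ h).congr' ?_))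
  filter_upwards [eventually_gt_atTop 0] with x hx
  exact clm_evolutionInv_variationOfConstants hB hx₀ hf Q c hx

end Annihilator

theorem HasExpDichotomy.mem_spaceUMinus_iff {v : E} : v ∈ spaceUMinus A B x₀ ↔ P v = v := by
  refine ⟨fun hv => ?_, fun hv => hv ▸ hP.apply_mem_spaceUMinus hB hx₀ ha v⟩
  have hPP : ∀ w, (1 - P) (P w) = 0 := fun w =>
    DFunLike.congr_fun hP.isIdempotentElem.one_sub_mul_self w
  have hlim : Tendsto (fun _ : ℝ => (1 - P) v) atTop (𝓝 0) := by
    refine (hP.tendsto_clm_evolutionInv hB hx₀ ha hPP (tendsto_zero_of_mem_spaceUMinus hv)).congr'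
      ?_
    filter_upwards [eventually_gt_atTop 0] with x hx
    rw [evolutionInv_evolution_apply hB hx₀ hx]
  exact (sub_eq_zero.1 (tendsto_nhds_unique tendsto_const_nhds hlim)).symm

variable {f : ℝ → E} (hf : ContinuousOn f (Ioi 0))
include hf

theorem HasExpDichotomy.variationOfConstants_eq {c : E} {r x : ℝ} (hr : 0 < r) (hx : 0 < x)
    (hf_lim : Tendsto f atTop (𝓝 0))
    (h : (1 - P) c = -∫ s in Ioi x₀, (1 - P) (evolutionInv A B x₀ s (f s))) :
    variationOfConstants A B x₀ f c x =
      evolution A B x₀ x (P (evolutionInv A B x₀ r (variationOfConstants A B x₀ f c r))) +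
      (∫ s in r..x, evolution A B x₀ x (P (evolutionInv A B x₀ s (f s)))) -
      ∫ s in Ioi x, evolution A B x₀ x ((1 - P) (evolutionInv A B x₀ s (f s))) := by
  set u : ℝ → E := fun x => evolutionInv A B x₀ x (variationOfConstants A B x₀ f c x) with hu
  have hint : ∀ b, 0 < b → IntegrableOn (fun s => (1 - P) (evolutionInv A B x₀ s (f s))) (Ioi b) :=
    fun b hb => hP.integrableOn_Ioi_clm_evolutionInv hB hx₀ ha
      (DFunLike.congr_fun hP.isIdempotentElem.one_sub_mul_self) hf hf_lim hb
  have hstable : P (u x) = P (u r) + ∫ s in r..x, P (evolutionInv A B x₀ s (f s)) :=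
    (sub_eq_iff_eq_add'.1 (clm_evolutionInv_variationOfConstants_sub hB hx₀ hf P c hr hx))
  have hunstable : (1 - P) (u x) = -∫ s in Ioi x, (1 - P) (evolutionInv A B x₀ s (f s)) := by
    rw [hu, clm_evolutionInv_variationOfConstants hB hx₀ hf (1 - P) c hx, h,
      ← intervalIntegral.integral_interval_add_Ioi (hint x₀ hx₀) (hint x hx)]
    abel
  have hPint := intervalIntegrable_clm_evolutionInv hB hx₀ hf (A := A) P hr hx
  calc variationOfConstants A B x₀ f c x = evolution A B x₀ x (P (u x) + (1 - P) (u x)) := by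
        rw [sub_apply, one_apply_eq_self, add_sub_cancel, evolution_evolutionInv_apply hB hx₀ hx]
    _ = _ := by
      rw [hstable, hunstable, map_add, map_add, map_neg, ← sub_eq_add_neg,
        (evolution A B x₀ x).intervalIntegral_comp_comm hPint,
        (evolution A B x₀ x).integral_comp_comm (hint x hx)]

theorem HasExpDichotomy.tendsto_variationOfConstants (hf_lim : Tendsto f atTop (𝓝 0)) {c : E}
    (h : (1 - P) c = -∫ s in Ioi x₀, (1 - P) (evolutionInv A B x₀ s (f s))) :
    Tendsto (variationOfConstants A B x₀ f c) atTop (𝓝 0) := by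
  rw [Metric.tendsto_nhds]
  intro η hη
  obtain ⟨ε, hε, hKε⟩ : ∃ ε > 0, K * ε * γ⁻¹ = η / 3 :=
    ⟨γ * (η / 3) / K, div_pos (mul_pos hP.rate_pos (by positivity)) hP.const_pos, by
      field_simp [hP.const_pos.ne', hP.rate_pos.ne']⟩
  obtain ⟨r₀, hr₀⟩ := eventually_atTop.1
    (hf_lim.norm.eventually (ge_mem_nhds (show ‖(0 : E)‖ < ε by simpa using hε)))
  set r := max a r₀
  have hr : 0 < r := ha.trans_le (le_max_left a r₀)
  have hfε : ∀ s, r ≤ s → ‖f s‖ ≤ ε := fun s hs => hr₀ s ((le_max_right a r₀).trans hs)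
  have hdecay := (tendsto_zero_of_mem_spaceUMinus (hP.apply_mem_spaceUMinus hB hx₀ ha
    (evolutionInv A B x₀ r (variationOfConstants A B x₀ f c r)))).norm.eventually_lt_const
    (show ‖(0 : E)‖ < η / 3 by simpa using by positivity)
  filter_upwards [hdecay, eventually_ge_atTop r] with x hx hrx
  have hax : a ≤ x := (le_max_left a r₀).trans hrx
  rw [dist_zero_right, hP.variationOfConstants_eq hB hx₀ ha hf hr (hr.trans_le hrx) hf_lim h]
  calc _ ≤ _ := (norm_sub_le _ _).trans (add_le_add_left (norm_add_le _ _) _)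
    _ < η / 3 + η / 3 + η / 3 := add_lt_add_of_lt_of_le
      (add_lt_add_of_lt_of_le hx
        ((hP.norm_integral_stable_le (le_max_left a r₀) hrx hfε).trans_eq hKε))
      ((hP.norm_integral_unstable_le hax fun s hs => hfε s (hrx.trans hs)).trans_eq hKε)
    _ = η := add_thirds η

omit hP in
theorem IsExpDichotomic.integrableOn_Ioi_clm_evolutionInv (h : IsExpDichotomic A B a)
    {F : Type*} [NormedAddCommGroup F] [NormedSpace ℝ F] {Q : E →L[ℝ] F}
    (hQ : ∀ v ∈ spaceUMinus A B x₀, Q v = 0) (hf_lim : Tendsto f atTop (𝓝 0)) {b : ℝ}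
    (hb : 0 < b) : IntegrableOn (fun s => Q (evolutionInv A B x₀ s (f s))) (Ioi b) := by
  obtain ⟨P, K, γ, hP⟩ := exists_hasExpDichotomy hB hx₀ ha h
  exact hP.integrableOn_Ioi_clm_evolutionInv hB hx₀ ha
    (fun v => hQ _ (hP.apply_mem_spaceUMinus hB hx₀ ha v)) hf hf_lim hb

omit hP in
theorem IsExpDichotomic.tendsto_variationOfConstants_iff (h : IsExpDichotomic A B a)
    {F : Type*} [NormedAddCommGroup F] [NormedSpace ℝ F] [CompleteSpace F] {Q : E →L[ℝ] F}
    (hQ : ∀ v, Q v = 0 ↔ v ∈ spaceUMinus A B x₀) (hf_lim : Tendsto f atTop (𝓝 0)) {c : E} :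
    Tendsto (variationOfConstants A B x₀ f c) atTop (𝓝 0) ↔
      Q c = -∫ s in Ioi x₀, Q (evolutionInv A B x₀ s (f s)) := by
  obtain ⟨P, K, γ, hP⟩ := exists_hasExpDichotomy hB hx₀ ha h
  have hQP : ∀ v, Q (P v) = 0 := fun v => (hQ _).2 (hP.apply_mem_spaceUMinus hB hx₀ ha v)
  refine ⟨hP.clm_eq_neg_integral_of_tendsto hB hx₀ ha hQP hf hf_lim, fun hc =>
    hP.tendsto_variationOfConstants hB hx₀ ha hf hf_lim ?_⟩
  have hint := hP.integrableOn_Ioi_clm_evolutionInv hB hx₀ ha (Q := 1 - P)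
    (DFunLike.congr_fun hP.isIdempotentElem.one_sub_mul_self) hf hf_lim hx₀
  -- The defect `w` is annihilated by `Q`, hence fixed by `P`, and it lies in the kernel of `P`.
  set w := (1 - P) c + ∫ s in Ioi x₀, (1 - P) (evolutionInv A B x₀ s (f s)) with hw
  have hQw : Q w = 0 := by
    rw [hw, map_add, ← Q.integral_comp_comm hint]
    simp [hQP, hc]
  have hPw : P w = 0 := by
    rw [hw, map_add, ← P.integral_comp_comm hint]
    have hPP' : ∀ v, P (P v) = P v := DFunLike.congr_fun hP.isIdempotentElem
    simp [hPP']
  rw [eq_neg_iff_add_eq_zero, ← hw, ← (hP.mem_spaceUMinus_iff hB hx₀ ha).1 ((hQ w).1 hQw), hPw]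

end NearInfinity

section Projectors

variable {E : Type*} [NormedAddCommGroup E] [NormedSpace ℝ E] [FiniteDimensional ℝ E]
  {A : E →L[ℝ] E} {B : ℝ → E →L[ℝ] E} {x₀ : ℝ} {V0 : Submodule ℝ E} {L : Fin 6 → Submodule ℝ E}
  (hL : IsSplitting A B x₀ V0 L)
include hL

theorem IsSplitting.proj_apply (i : Fin 6) (v : E) :
    proj L i v = (L i).projection _ (hL.isCompl i) v := by
  rw [proj, dif_pos (hL.isCompl i)]
  rfl

theorem IsSplitting.proj_mem (i : Fin 6) (v : E) : proj L i v ∈ L i := by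
  rw [hL.proj_apply]
  exact Submodule.projection_apply_mem _ _

theorem IsSplitting.proj_of_mem {i : Fin 6} {v : E} (hv : v ∈ L i) (j : Fin 6) :
    proj L j v = if i = j then v else 0 := by
  rw [hL.proj_apply]
  split_ifs with hij
  · subst hij
    exact Submodule.projection_apply_of_mem_left _ hv
  · exact (Submodule.projection_apply_eq_zero_iff _).2
      (Submodule.mem_iSup_of_mem i (Submodule.mem_iSup_of_mem hij hv))

theorem IsSplitting.proj_proj (i j : Fin 6) (v : E) :
    proj L j (proj L i v) = if i = j then proj L i v else 0 :=
  hL.proj_of_mem (hL.proj_mem i v) j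

omit [FiniteDimensional ℝ E] in
theorem IsSplitting.iSup_eq_top : ⨆ i, L i = ⊤ := by
  rw [eq_top_iff, ← (hL.isCompl 0).sup_eq_top]
  exact sup_le (le_iSup L 0) (iSup_le fun j => iSup_le fun _ => le_iSup L j)

theorem IsSplitting.sum_proj (v : E) : ∑ i, proj L i v = v := by
  refine Submodule.iSup_induction L (motive := fun v => ∑ i, proj L i v = v)
    (hL.iSup_eq_top ▸ Submodule.mem_top) (fun i w hw => ?_) (by simp) fun u w hu hw => ?_
  · simp [hL.proj_of_mem hw]
  · simp only [map_add, Finset.sum_add_distrib, hu, hw]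

theorem IsSplitting.proj_apply_eq_zero_of_mem_spaceVPlus {v : E} (hv : v ∈ spaceVPlus A B x₀)
    {i : Fin 6} (h0 : i ≠ 0) (h3 : i ≠ 3) : proj L i v = 0 := by
  obtain ⟨u, hu, w, hw, rfl⟩ := Submodule.mem_sup.1 (hL.sup_L4 ▸ hv)
  rw [map_add, hL.proj_of_mem hu, hL.proj_of_mem hw, if_neg h0.symm, if_neg h3.symm, add_zero]

theorem IsSplitting.proj_apply_eq_zero_of_mem_spaceUMinus {v : E} (hv : v ∈ spaceUMinus A B x₀)
    {i : Fin 6} (hi : 3 ≤ i) : proj L i v = 0 := by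
  rw [← hL.sup_L3, ← hL.sup_L2] at hv
  obtain ⟨t, ht, r, hr, rfl⟩ := Submodule.mem_sup.1 hv
  obtain ⟨u, hu, w, hw, rfl⟩ := Submodule.mem_sup.1 ht
  rw [map_add, map_add, hL.proj_of_mem hu, hL.proj_of_mem hw, hL.proj_of_mem hr,
    if_neg (by grind), if_neg (by grind), if_neg (by grind), add_zero, add_zero]

theorem IsSplitting.proj_eq_zero_iff_mem_spaceVPlus {v : E} :
    (proj L 1 + proj L 2 + proj L 4 + proj L 5) v = 0 ↔ v ∈ spaceVPlus A B x₀ := by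
  refine ⟨fun hv => ?_, fun hv => by simp [hL.proj_apply_eq_zero_of_mem_spaceVPlus hv]⟩
  have hdecomp : v = proj L 0 v + proj L 3 v +
      (proj L 1 + proj L 2 + proj L 4 + proj L 5) v := by
    nth_rw 1 [← hL.sum_proj v]
    simp only [Fin.sum_univ_six, add_apply]
    abel
  rw [hdecomp, hv, add_zero, ← hL.sup_L4]
  exact Submodule.add_mem_sup (hL.proj_mem 0 v) (hL.proj_mem 3 v)

theorem IsSplitting.proj_eq_zero_iff_mem_spaceUMinus {v : E} :
    (proj L 3 + proj L 4 + proj L 5) v = 0 ↔ v ∈ spaceUMinus A B x₀ := by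
  refine ⟨fun hv => ?_, fun hv => by simp [hL.proj_apply_eq_zero_of_mem_spaceUMinus hv]⟩
  have hdecomp : v = proj L 0 v + proj L 1 v + proj L 2 v +
      (proj L 3 + proj L 4 + proj L 5) v := by
    nth_rw 1 [← hL.sum_proj v]
    simp only [Fin.sum_univ_six, add_apply]
    abel
  rw [hdecomp, hv, add_zero, ← hL.sup_L3, ← hL.sup_L2]
  exact Submodule.add_mem_sup
    (Submodule.add_mem_sup (hL.proj_mem 0 v) (hL.proj_mem 1 v)) (hL.proj_mem 2 v)

end Projectors

section IndicatorIntegrals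

variable {X E : Type*} [MeasurableSpace X] {μ : Measure X} [NormedAddCommGroup E] {I J T : Set X}
  (hI : MeasurableSet I) (hJ : MeasurableSet J) {u w : X → E} (hu : IntegrableOn u I μ)
  (hw : IntegrableOn w J μ)
include hI hJ hu hw

theorem integrable_indicator_sub_indicator : Integrable (I.indicator u - J.indicator w) μ :=
  (hu.integrable_indicator hI).sub (hw.integrable_indicator hJ)

theorem setIntegral_indicator_sub_indicator [NormedSpace ℝ E] (hIT : I ⊆ T) (hJT : J ⊆ T) :
    ∫ s in T, (I.indicator u - J.indicator w) s ∂μ = ∫ s in I, u s ∂μ - ∫ s in J, w s ∂μ := by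
  rw [integral_sub' (hu.integrable_indicator hI).integrableOn
    (hw.integrable_indicator hJ).integrableOn, setIntegral_indicator hI, setIntegral_indicator hJ,
    inter_eq_right.2 hIT, inter_eq_right.2 hJT]

end IndicatorIntegrals

section GreenIntegrals

variable {E : Type*} [NormedAddCommGroup E] [NormedSpace ℝ E] [FiniteDimensional ℝ E]
  {A : E →L[ℝ] E} {B : ℝ → E →L[ℝ] E} {x₀ : ℝ} {L : Fin 6 → Submodule ℝ E} {g : ℝ → E}

/-- The initial value at `x₀` of the solution `x ↦ ∫₀^∞ G(x, s) g(s) ds`: the components along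
`L₂, L₃` are fixed by the behaviour at `0`, those along `L₄, L₅, L₆` by the behaviour at `∞`, and
the one along `L₁` is normalized to `0`. -/
noncomputable def greenInitialValue (A : E →L[ℝ] E) (B : ℝ → E →L[ℝ] E) (x₀ : ℝ)
    (L : Fin 6 → Submodule ℝ E) (g : ℝ → E) : E :=
  (∫ s in Ioc 0 x₀, (proj L 1 + proj L 2) (evolutionInv A B x₀ s (g s))) -
    ∫ s in Ioi x₀, (proj L 3 + proj L 4 + proj L 5) (evolutionInv A B x₀ s (g s))

theorem green1_apply_eq_indicator_sub (hx₀ : 0 < x₀) {x : ℝ} (hx : 0 < x) :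
    (fun s => green1 A B x₀ L x s (g s)) =
      (Icc x₀ x).indicator
        (fun s => (evolution A B x₀ x * proj L 0) (evolutionInv A B x₀ s (g s))) -
      (Ioo x x₀).indicator
        (fun s => (evolution A B x₀ x * proj L 0) (evolutionInv A B x₀ s (g s))) := by
  ext s
  have hDPlus : (x, s) ∈ setD x₀ ∩ setDPlus ↔ s ∈ Icc x₀ x := by
    simp only [setD, setDPlus, mem_inter_iff, mem_union, mem_ofPred_eq, mem_Icc]
    grind
  have hDMinus : (x, s) ∈ setD x₀ ∩ setDMinus ↔ s ∈ Ioo x x₀ := by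
    simp only [setD, setDMinus, mem_inter_iff, mem_union, mem_ofPred_eq, mem_Ioo]
    grind
  have hdisj : s ∈ Icc x₀ x → s ∉ Ioo x x₀ := fun h h' => h.2.not_gt h'.1
  simp only [green1, hDPlus, hDMinus, Pi.sub_apply]
  by_cases h₁ : s ∈ Icc x₀ x
  · simp [h₁, hdisj h₁]
  · by_cases h₂ : s ∈ Ioo x x₀ <;> simp [h₁, h₂]

theorem green2_apply_eq_indicator_sub {x : ℝ} (hx : 0 < x) :
    (fun s => green2 A B x₀ L x s (g s)) =
      (Ioc 0 x).indicator (fun s =>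
        evolution A B x₀ x ((proj L 1 + proj L 2) (evolutionInv A B x₀ s (g s)))) -
      (Ioi x).indicator (fun s => evolution A B x₀ x
        ((proj L 3 + proj L 4 + proj L 5) (evolutionInv A B x₀ s (g s)))) := by
  ext s
  have hDPlus : (x, s) ∈ setDPlus ↔ s ∈ Ioc 0 x := Iff.rfl
  have hDMinus : (x, s) ∈ setDMinus ↔ s ∈ Ioi x := and_iff_right hx
  have hdisj : s ∈ Ioc 0 x → s ∉ Ioi x := fun h => h.2.not_gt
  simp only [green2, hDPlus, hDMinus, Pi.sub_apply]
  by_cases h₁ : s ∈ Ioc 0 x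
  · simp [h₁, hdisj h₁]
  · by_cases h₂ : s ∈ Ioi x <;> simp [h₁, h₂]

section Integrals

variable (hB : ContinuousOn B (Ici 0)) (hx₀ : 0 < x₀) (hg : ContinuousOn g (Ioi 0))

section

variable (hS : ∀ b, IntegrableOn
    (fun s => (proj L 1 + proj L 2) (evolutionInv A B x₀ s (g s))) (Ioc 0 b))
  (hQ : ∀ b, 0 < b → IntegrableOn
    (fun s => (proj L 3 + proj L 4 + proj L 5) (evolutionInv A B x₀ s (g s))) (Ioi b))
include hS hQ

theorem integrable_green2 {x : ℝ} (hx : 0 < x) :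
    Integrable fun s => green2 A B x₀ L x s (g s) := by
  rw [green2_apply_eq_indicator_sub hx]
  exact integrable_indicator_sub_indicator measurableSet_Ioc measurableSet_Ioi
    ((evolution A B x₀ x).integrable_comp (hS x)) ((evolution A B x₀ x).integrable_comp (hQ x hx))

theorem integral_green2 {x : ℝ} (hx : 0 < x) :
    ∫ s in Ioi 0, green2 A B x₀ L x s (g s) = evolution A B x₀ x
      ((∫ s in Ioc 0 x, (proj L 1 + proj L 2) (evolutionInv A B x₀ s (g s))) -
        ∫ s in Ioi x, (proj L 3 + proj L 4 + proj L 5) (evolutionInv A B x₀ s (g s))) := by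
  have := FiniteDimensional.complete ℝ E
  rw [green2_apply_eq_indicator_sub hx, setIntegral_indicator_sub_indicator measurableSet_Ioc
    measurableSet_Ioi ((evolution A B x₀ x).integrable_comp (hS x))
    ((evolution A B x₀ x).integrable_comp (hQ x hx)) Ioc_subset_Ioi_self (Ioi_subset_Ioi hx.le),
    ContinuousLinearMap.integral_comp_comm _ (hS x),
    ContinuousLinearMap.integral_comp_comm _ (hQ x hx), map_sub]

end

include hB hx₀ hg

theorem integrable_green1 {x : ℝ} (hx : 0 < x) :
    Integrable fun s => green1 A B x₀ L x s (g s) := by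
  have := FiniteDimensional.complete ℝ E
  have hint := intervalIntegrable_clm_evolutionInv hB hx₀ hg (A := A)
    (evolution A B x₀ x * proj L 0) hx₀ hx
  rw [green1_apply_eq_indicator_sub hx₀ hx]
  exact integrable_indicator_sub_indicator measurableSet_Icc measurableSet_Ioo
    ((integrableOn_Icc_iff_integrableOn_Ioc enorm_ne_top).2 hint.1)
    (hint.2.mono_set Ioo_subset_Ioc_self)

theorem integral_green1 {x : ℝ} (hx : 0 < x) :
    ∫ s in Ioi 0, green1 A B x₀ L x s (g s) =
      evolution A B x₀ x (proj L 0 (∫ s in x₀..x, evolutionInv A B x₀ s (g s))) := by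
  have := FiniteDimensional.complete ℝ E
  have hint := intervalIntegrable_clm_evolutionInv hB hx₀ hg (A := A)
    (evolution A B x₀ x * proj L 0) hx₀ hx
  have hIcc : Icc x₀ x ⊆ Ioi 0 := fun s hs => hx₀.trans_le hs.1
  have hIoo : Ioo x x₀ ⊆ Ioi 0 := fun s hs => hx.trans hs.1
  rw [green1_apply_eq_indicator_sub hx₀ hx, setIntegral_indicator_sub_indicator measurableSet_Icc
    measurableSet_Ioo ((integrableOn_Icc_iff_integrableOn_Ioc enorm_ne_top).2 hint.1)
    (hint.2.mono_set Ioo_subset_Ioc_self) hIcc hIoo, integral_Icc_eq_integral_Ioc,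
    ← integral_Ioc_eq_integral_Ioo, ← intervalIntegral,
    ContinuousLinearMap.intervalIntegral_comp_comm _
      (intervalIntegrable_evolutionInv_apply hB hx₀ hg hx₀ hx), mul_apply_eq_comp]

theorem IsSplitting.integral_green {V0 : Submodule ℝ E} (hL : IsSplitting A B x₀ V0 L)
    (hS : ∀ b, IntegrableOn
      (fun s => (proj L 1 + proj L 2) (evolutionInv A B x₀ s (g s))) (Ioc 0 b))
    (hQ : ∀ b, 0 < b → IntegrableOn
      (fun s => (proj L 3 + proj L 4 + proj L 5) (evolutionInv A B x₀ s (g s))) (Ioi b))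
    {x : ℝ} (hx : 0 < x) :
    ∫ s in Ioi 0, green A B x₀ L x s (g s) =
      variationOfConstants A B x₀ g (greenInitialValue A B x₀ L g) x := by
  have := FiniteDimensional.complete ℝ E
  simp only [green, add_apply]
  rw [integral_add (integrable_green1 hB hx₀ hg hx).integrableOn
    (integrable_green2 hS hQ hx).integrableOn, integral_green1 hB hx₀ hg hx,
    integral_green2 hS hQ hx, setIntegral_Ioc_clm_evolutionInv hB hx₀ hg (hS x₀) hx,
    setIntegral_Ioi_clm_evolutionInv hB hx₀ hg hx hQ, ← map_add, variationOfConstants,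
    greenInitialValue]
  set F := ∫ s in x₀..x, evolutionInv A B x₀ s (g s)
  nth_rw 4 [← hL.sum_proj F]
  simp only [Fin.sum_univ_six, add_apply]
  congr 1
  abel

end Integrals

end GreenIntegrals

theorem isBigO_one_nhdsGT_of_continuousOn_Ici {F : Type*} [NormedAddCommGroup F] {f : ℝ → F}
    {a : ℝ} (hf : ContinuousOn f (Ici a)) : f =O[𝓝[>] a] fun _ => (1 : ℝ) :=
  ((hf a self_mem_Ici).mono Ioi_subset_Ici_self).tendsto.isBigO_one ℝ

section BoundaryValueProblem

variable {E : Type*} [NormedAddCommGroup E] [NormedSpace ℝ E] [FiniteDimensional ℝ E]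
  {A : E →L[ℝ] E} {B : ℝ → E →L[ℝ] E} {x₀ : ℝ} {g : ℝ → E}

variable (hA : ∀ z : ℂ, Polynomial.aeval z (LinearMap.charpoly (A : E →ₗ[ℝ] E)) = 0 → z.re ≠ 1)
  (hB : ContinuousOn B (Ici 0)) (hx₀ : 0 < x₀) (hg : ContinuousOn g (Ici 0))
include hA hB hx₀ hg

theorem isBVPSolution_iff_isBigO {y : ℝ → E} :
    IsBVPSolution A B g y ↔ y 0 = 0 ∧ ∃ c,
      EqOn y (variationOfConstants A B x₀ g c) (Ioi 0) ∧
      variationOfConstants A B x₀ g c =O[𝓝[>] 0] (fun x => x) ∧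
      Tendsto (variationOfConstants A B x₀ g c) atTop (𝓝 0) := by
  have := FiniteDimensional.complete ℝ E
  have hg' : ContinuousOn g (Ioi 0) := hg.mono Ioi_subset_Ici_self
  constructor
  · intro hy
    obtain ⟨hy0, hyO⟩ := isBigO_id_of_contDiffOn_Ici hy.contDiffOn hy.tendsto_zero
    obtain ⟨c, hc⟩ := exists_eqOn_variationOfConstants hB hx₀ hg' isOpen_Ioi isPreconnected_Ioi
      subset_rfl hy.hasDerivAt
    exact ⟨hy0, c, hc, hyO.congr' (hc.eventuallyEq_of_mem self_mem_nhdsWithin) .rfl,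
      hy.tendsto_atTop.congr' (hc.eventuallyEq_of_mem (Ioi_mem_atTop 0))⟩
  · rintro ⟨hy0, c, hc, hO, hlim⟩
    have hderiv : ∀ x, 0 < x → HasDerivAt y (coeff A B x (y x) + g x) x := by
      intro x hx
      rw [hc hx]
      exact (hasDerivAt_variationOfConstants hB hx₀ hg' c hx).congr_of_eventuallyEq
        (hc.eventuallyEq_of_mem (Ioi_mem_nhds hx))
    have hyO : y =O[𝓝[>] 0] fun x => x :=
      hO.congr' (hc.eventuallyEq_of_mem self_mem_nhdsWithin).symm .rfl
    exact ⟨contDiffOn_of_isBigO hB hA hg hderiv hy0 hyO, hderiv,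
      hyO.trans_tendsto (tendsto_id.mono_left nhdsWithin_le_nhds),
      hlim.congr' (hc.eventuallyEq_of_mem (Ioi_mem_atTop 0)).symm⟩

variable {V0 : Submodule ℝ E} {L : Fin 6 → Submodule ℝ E} (hL : IsSplitting A B x₀ V0 L)
include hL

theorem IsSplitting.integrableOn_Ioc_proj_evolutionInv {i : Fin 6} (h0 : i ≠ 0) (h3 : i ≠ 3)
    (b : ℝ) : IntegrableOn (fun s => proj L i (evolutionInv A B x₀ s (g s))) (Ioc 0 b) :=
  integrableOn_clm_evolutionInv hB hA hx₀
    (fun _ hv => hL.proj_apply_eq_zero_of_mem_spaceVPlus hv h0 h3)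
    (hg.mono Ioi_subset_Ici_self) (isBigO_one_nhdsGT_of_continuousOn_Ici hg) b

theorem IsSplitting.integrableOn_Ioc_proj12_evolutionInv (b : ℝ) :
    IntegrableOn (fun s => (proj L 1 + proj L 2) (evolutionInv A B x₀ s (g s))) (Ioc 0 b) :=
  (hL.integrableOn_Ioc_proj_evolutionInv hA hB hx₀ hg (by decide) (by decide) b).add
    (hL.integrableOn_Ioc_proj_evolutionInv hA hB hx₀ hg (by decide) (by decide) b)

theorem IsSplitting.integrableOn_Ioc_proj45_evolutionInv (b : ℝ) :
    IntegrableOn (fun s => (proj L 4 + proj L 5) (evolutionInv A B x₀ s (g s))) (Ioc 0 b) :=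
  (hL.integrableOn_Ioc_proj_evolutionInv hA hB hx₀ hg (by decide) (by decide) b).add
    (hL.integrableOn_Ioc_proj_evolutionInv hA hB hx₀ hg (by decide) (by decide) b)

variable {a : ℝ} (ha : 0 < a) (hdich : IsExpDichotomic A B a) (hg_lim : Tendsto g atTop (𝓝 0))
include ha hdich hg_lim

section AtTop

omit hA

theorem IsSplitting.integrableOn_Ioi_proj_evolutionInv {i : Fin 6} (hi : 3 ≤ i) {b : ℝ}
    (hb : 0 < b) : IntegrableOn (fun s => proj L i (evolutionInv A B x₀ s (g s))) (Ioi b) := by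
  have := FiniteDimensional.complete ℝ E
  exact hdich.integrableOn_Ioi_clm_evolutionInv hB hx₀ ha (hg.mono Ioi_subset_Ici_self)
    (fun _ hv => hL.proj_apply_eq_zero_of_mem_spaceUMinus hv hi) hg_lim hb

theorem IsSplitting.integrableOn_Ioi_proj345_evolutionInv {b : ℝ} (hb : 0 < b) :
    IntegrableOn (fun s => (proj L 3 + proj L 4 + proj L 5) (evolutionInv A B x₀ s (g s)))
      (Ioi b) :=
  ((hL.integrableOn_Ioi_proj_evolutionInv hB hx₀ hg ha hdich hg_lim le_rfl hb).add
    (hL.integrableOn_Ioi_proj_evolutionInv hB hx₀ hg ha hdich hg_lim (by decide) hb)).add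
    (hL.integrableOn_Ioi_proj_evolutionInv hB hx₀ hg ha hdich hg_lim (by decide) hb)

theorem IsSplitting.integrableOn_Ioi_proj45_evolutionInv {b : ℝ} (hb : 0 < b) :
    IntegrableOn (fun s => (proj L 4 + proj L 5) (evolutionInv A B x₀ s (g s))) (Ioi b) :=
  (hL.integrableOn_Ioi_proj_evolutionInv hB hx₀ hg ha hdich hg_lim (by decide) hb).add
    (hL.integrableOn_Ioi_proj_evolutionInv hB hx₀ hg ha hdich hg_lim (by decide) hb)

end AtTop

theorem IsSplitting.integrableOn_proj45_evolutionInv :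
    IntegrableOn (fun s => (proj L 4 + proj L 5) (evolutionInv A B x₀ s (g s))) (Ioi 0) := by
  rw [← Ioc_union_Ioi_eq_Ioi hx₀.le]
  exact (hL.integrableOn_Ioc_proj45_evolutionInv hA hB hx₀ hg x₀).union
    (hL.integrableOn_Ioi_proj45_evolutionInv hB hx₀ hg ha hdich hg_lim hx₀)

theorem IsSplitting.integrableOn_green {x : ℝ} (hx : 0 < x) :
    IntegrableOn (fun s => green A B x₀ L x s (g s)) (Ioi 0) :=
  ((integrable_green1 hB hx₀ (hg.mono Ioi_subset_Ici_self) hx).add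
    (integrable_green2 (hL.integrableOn_Ioc_proj12_evolutionInv hA hB hx₀ hg)
      (fun _ => hL.integrableOn_Ioi_proj345_evolutionInv hB hx₀ hg ha hdich hg_lim)
      hx)).integrableOn

theorem IsSplitting.proj345_greenInitialValue :
    (proj L 3 + proj L 4 + proj L 5) (greenInitialValue A B x₀ L g) =
      -∫ s in Ioi x₀, (proj L 3 + proj L 4 + proj L 5) (evolutionInv A B x₀ s (g s)) := by
  have := FiniteDimensional.complete ℝ E
  rw [greenInitialValue, map_sub,
    ← ContinuousLinearMap.integral_comp_comm _
      (hL.integrableOn_Ioc_proj12_evolutionInv hA hB hx₀ hg x₀),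
    ← ContinuousLinearMap.integral_comp_comm _
      (hL.integrableOn_Ioi_proj345_evolutionInv hB hx₀ hg ha hdich hg_lim hx₀)]
  simp [hL.proj_proj]

theorem IsSplitting.proj1245_greenInitialValue :
    (proj L 1 + proj L 2 + proj L 4 + proj L 5) (greenInitialValue A B x₀ L g) =
      (∫ s in Ioc 0 x₀, (proj L 1 + proj L 2 + proj L 4 + proj L 5)
        (evolutionInv A B x₀ s (g s))) -
      ∫ s in Ioi 0, (proj L 4 + proj L 5) (evolutionInv A B x₀ s (g s)) := by
  have := FiniteDimensional.complete ℝ E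
  have h12 := hL.integrableOn_Ioc_proj12_evolutionInv hA hB hx₀ hg x₀
  have h45 := hL.integrableOn_Ioc_proj45_evolutionInv hA hB hx₀ hg x₀
  have hsplit := setIntegral_union (Ioc_disjoint_Ioi le_rfl) measurableSet_Ioi h45
    (hL.integrableOn_Ioi_proj45_evolutionInv hB hx₀ hg ha hdich hg_lim hx₀)
  rw [Ioc_union_Ioi_eq_Ioi hx₀.le] at hsplit
  have hadd : ∀ v, (proj L 1 + proj L 2 + proj L 4 + proj L 5) v =
      (proj L 1 + proj L 2) v + (proj L 4 + proj L 5) v := fun v => by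
    simp only [add_apply, add_assoc]
  have hidem : ∀ v, (proj L 1 + proj L 2 + proj L 4 + proj L 5) ((proj L 1 + proj L 2) v) =
      (proj L 1 + proj L 2) v := fun v => by
    simp [hL.proj_proj]
  have hoverlap : ∀ v, (proj L 1 + proj L 2 + proj L 4 + proj L 5)
      ((proj L 3 + proj L 4 + proj L 5) v) = (proj L 4 + proj L 5) v := fun v => by
    simp [hL.proj_proj]
  rw [hsplit, greenInitialValue, map_sub, ← ContinuousLinearMap.integral_comp_comm _ h12,
    ← ContinuousLinearMap.integral_comp_comm _
      (hL.integrableOn_Ioi_proj345_evolutionInv hB hx₀ hg ha hdich hg_lim hx₀)]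
  simp only [hidem, hoverlap]
  simp only [hadd, integral_add h12 h45]
  abel

theorem IsSplitting.isBVPSolution_iff_proj_eq {y : ℝ → E} :
    IsBVPSolution A B g y ↔ y 0 = 0 ∧ ∃ v,
      (∀ x, 0 < x → y x = evolution A B x₀ x v + ∫ s in Ioi 0, green A B x₀ L x s (g s)) ∧
      (proj L 1 + proj L 2 + proj L 4 + proj L 5) v =
        (∫ s in Ioi 0, (proj L 4 + proj L 5) (evolutionInv A B x₀ s (g s))) ∧
      (proj L 3 + proj L 4 + proj L 5) v = 0 := by
  have := FiniteDimensional.complete ℝ E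
  have hg' : ContinuousOn g (Ioi 0) := hg.mono Ioi_subset_Ici_self
  rw [isBVPSolution_iff_isBigO hA hB hx₀ hg]
  refine and_congr_right fun _ =>
    ((Equiv.addLeft (greenInitialValue A B x₀ L g)).exists_congr fun v => ?_).symm
  rw [Equiv.coe_addLeft, isBigO_variationOfConstants_iff hB hA hx₀
      (fun _ => hL.proj_eq_zero_iff_mem_spaceVPlus) hg' (isBigO_one_nhdsGT_of_continuousOn_Ici hg),
    hdich.tendsto_variationOfConstants_iff hB hx₀ ha hg'
      (fun _ => hL.proj_eq_zero_iff_mem_spaceUMinus) hg_lim, map_add, map_add,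
    hL.proj345_greenInitialValue hA hB hx₀ hg ha hdich hg_lim,
    hL.proj1245_greenInitialValue hA hB hx₀ hg ha hdich hg_lim, sub_add_eq_add_sub,
    sub_eq_iff_eq_add, add_right_inj, add_eq_left]
  refine and_congr_left' (forall₂_congr fun x hx => ?_)
  rw [variationOfConstants_add, hL.integral_green hB hx₀ hg'
    (hL.integrableOn_Ioc_proj12_evolutionInv hA hB hx₀ hg)
    (fun _ => hL.integrableOn_Ioi_proj345_evolutionInv hB hx₀ hg ha hdich hg_lim) hx, add_comm]

theorem IsSplitting.isBVPSolution_iff {y : ℝ → E} :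
    IsBVPSolution A B g y ↔
      (∫ s in Ioi 0, (proj L 4 + proj L 5) (evolutionInv A B x₀ s (g s))) = 0 ∧
      y 0 = 0 ∧ ∃ v ∈ L 0, ∀ x, 0 < x →
        y x = evolution A B x₀ x v + ∫ s in Ioi 0, green A B x₀ L x s (g s) := by
  have := FiniteDimensional.complete ℝ E
  rw [hL.isBVPSolution_iff_proj_eq hA hB hx₀ hg ha hdich hg_lim]
  set J := ∫ s in Ioi 0, (proj L 4 + proj L 5) (evolutionInv A B x₀ s (g s)) with hJ
  have hJ_proj : (proj L 4 + proj L 5) J = J := by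
    rw [hJ, ← ContinuousLinearMap.integral_comp_comm _
      (hL.integrableOn_proj45_evolutionInv hA hB hx₀ hg ha hdich hg_lim)]
    simp [hL.proj_proj]
  have hmem : ∀ v, (proj L 1 + proj L 2 + proj L 4 + proj L 5) v = 0 ∧
      (proj L 3 + proj L 4 + proj L 5) v = 0 ↔ v ∈ L 0 := fun v => by
    rw [hL.proj_eq_zero_iff_mem_spaceVPlus, hL.proj_eq_zero_iff_mem_spaceUMinus, hL.L1_eq,
      and_comm, Submodule.mem_inf]
  constructor
  · rintro ⟨hy0, v, hy, hv₀, hv⟩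
    have hJ_zero : J = 0 := calc
      J = (proj L 4 + proj L 5) ((proj L 1 + proj L 2 + proj L 4 + proj L 5) v) := by
        rw [hv₀, hJ_proj]
      _ = (proj L 4 + proj L 5) ((proj L 3 + proj L 4 + proj L 5) v) := by
        simp [hL.proj_proj]
      _ = 0 := by rw [hv, map_zero]
    exact ⟨hJ_zero, hy0, v, (hmem v).1 ⟨hv₀.trans hJ_zero, hv⟩, hy⟩
  · rintro ⟨hJ_zero, hy0, v, hv, hy⟩
    obtain ⟨hv₀, hv⟩ := (hmem v).2 hv
    exact ⟨hy0, v, hy, hv₀.trans hJ_zero.symm, hv⟩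

end BoundaryValueProblem

end SingularODE

theorem mainTheorem3_general {E : Type*} [NormedAddCommGroup E] [NormedSpace ℝ E]
    [FiniteDimensional ℝ E] (A : E →L[ℝ] E) (B : ℝ → E →L[ℝ] E) (hB : ContinuousOn B (Ici 0))
    (hA : ∀ z : ℂ, Polynomial.aeval z (LinearMap.charpoly (A : E →ₗ[ℝ] E)) = 0 → z.re ≠ 1)
    (hdich : ∃ a, 0 < a ∧ SingularODE.IsExpDichotomic A B a)
    (x₀ : ℝ) (hx₀ : 0 < x₀)
    (V0 : Submodule ℝ E) (L : Fin 6 → Submodule ℝ E)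
    (hL : SingularODE.IsSplitting A B x₀ V0 L)
    (g : ℝ → E) (hg : ContinuousOn g (Ici 0)) (hg_lim : Tendsto g atTop (𝓝 0)) :
    IntegrableOn
      (fun s => (SingularODE.proj L 4 + SingularODE.proj L 5)
        (SingularODE.evolutionInv A B x₀ s (g s))) (Ioi 0) ∧
    (∀ x, 0 < x → IntegrableOn (fun s => SingularODE.green A B x₀ L x s (g s)) (Ioi 0)) ∧
    ((∃ y : ℝ → E, SingularODE.IsBVPSolution A B g y) ↔
      (∫ s in Ioi (0 : ℝ), (SingularODE.proj L 4 + SingularODE.proj L 5)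
        (SingularODE.evolutionInv A B x₀ s (g s))) = 0) ∧
    ((∫ s in Ioi (0 : ℝ), (SingularODE.proj L 4 + SingularODE.proj L 5)
        (SingularODE.evolutionInv A B x₀ s (g s))) = 0 →
      ∀ y : ℝ → E, SingularODE.IsBVPSolution A B g y ↔
        y 0 = 0 ∧ ∃ v ∈ L 0, ∀ x, 0 < x →
          y x = SingularODE.evolution A B x₀ x v +
            ∫ s in Ioi (0 : ℝ), SingularODE.green A B x₀ L x s (g s)) := by
  obtain ⟨a, ha, hdich⟩ := hdich
  have hsol : ∀ y : ℝ → E, SingularODE.IsBVPSolution A B g y ↔ _ := fun _ =>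
    hL.isBVPSolution_iff hA hB hx₀ hg ha hdich hg_lim
  refine ⟨hL.integrableOn_proj45_evolutionInv hA hB hx₀ hg ha hdich hg_lim,
    fun _ hx => hL.integrableOn_green hA hB hx₀ hg ha hdich hg_lim hx,
    ⟨fun ⟨y, hy⟩ => ((hsol y).1 hy).1, fun hzero => ?_⟩,
    fun hzero y => (hsol y).trans (and_iff_right hzero)⟩
  refine ⟨fun x => if x = 0 then 0 else ∫ s in Ioi 0, SingularODE.green A B x₀ L x s (g s),
    (hsol _).2 ⟨hzero, if_pos rfl, 0, zero_mem _, fun x hx => ?_⟩⟩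
  rw [if_neg hx.ne', map_zero, zero_add]

theorem mainTheorem3 {E : Type*} [NormedAddCommGroup E] [InnerProductSpace ℝ E]
    [FiniteDimensional ℝ E]
    (A : E →L[ℝ] E) (B : ℝ → E →L[ℝ] E)
    (hB : ContinuousOn B (Ici 0)) (hB_bdd : ∃ M, ∀ x, 0 ≤ x → ‖B x‖ ≤ M)
    (hA : ∀ z : ℂ, Polynomial.aeval z (LinearMap.charpoly (A : E →ₗ[ℝ] E)) = 0 → z.re ≠ 1)
    (hdich : ∃ a, 0 < a ∧ SingularODE.IsExpDichotomic A B a)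
    (x₀ : ℝ) (hx₀ : 0 < x₀)
    (V0 : Submodule ℝ E) (L : Fin 6 → Submodule ℝ E)
    (hL : SingularODE.IsSplitting A B x₀ V0 L)
    (g : ℝ → E) (hg : ContinuousOn g (Ici 0)) (hg_lim : Tendsto g atTop (𝓝 0)) :
    IntegrableOn
      (fun s => (SingularODE.proj L 4 + SingularODE.proj L 5)
        (SingularODE.evolutionInv A B x₀ s (g s))) (Ioi 0) ∧
    (∀ x, 0 < x → IntegrableOn (fun s => SingularODE.green A B x₀ L x s (g s)) (Ioi 0)) ∧
    ((∃ y : ℝ → E, SingularODE.IsBVPSolution A B g y) ↔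
      (∫ s in Ioi (0 : ℝ), (SingularODE.proj L 4 + SingularODE.proj L 5)
        (SingularODE.evolutionInv A B x₀ s (g s))) = 0) ∧
    ((∫ s in Ioi (0 : ℝ), (SingularODE.proj L 4 + SingularODE.proj L 5)
        (SingularODE.evolutionInv A B x₀ s (g s))) = 0 →
      ∀ y : ℝ → E, SingularODE.IsBVPSolution A B g y ↔
        y 0 = 0 ∧ ∃ v ∈ L 0, ∀ x, 0 < x →
          y x = SingularODE.evolution A B x₀ x v +
            ∫ s in Ioi (0 : ℝ), SingularODE.green A B x₀ L x s (g s)) :=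
  mainTheorem3_general A B hB hA hdich x₀ hx₀ V0 L hL g hg hg_lim
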